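/- Let $p>3$ be a prime and let $d\neq 0$ be a rational number whose numerator (in lowest terms) is not divisible by $p$. For rational numbers $a,b$ write $a\equiv b \pmod{p^n}$ if $a-b=p^n c$ for some rational number $c$ whose denominator is prime to $p$. Let $q_p(a)=(a^{p-1}-1)/p$ be the Fermat quotient, $\left(\frac{\cdot}{\cdot}\right)$ the Jacobi symbol, $B_n(x)$ the Bernoulli polynomials, and $E_n$ the Euler numbers, defined by $\frac{2e^t}{e^{2t}+1}=\sum_{n\ge 0}E_n\frac{t^n}{n!}$. Then $$\sum_{k=0}^{(p-1)/2}\left(1+(4-d)k^2+\tfrac{8+d}{2}k\right)\frac{\binom{2k}{k}}{d^k}\equiv\left(-\tfrac1d\right)^{(p-1)/2}p^2\left(1+2p\,q_p(2)+p^2q_p(2)^2\right)\pmod{p^5};$$ $$\sum_{k=0}^{(p-1)/2}\left(1+\tfrac{27-4d}{6}k^2+\tfrac{27+2d}{6}k\right)\frac{\binom{3k}{k}}{d^k}\equiv\begin{cases}\dfrac{(-1)^{(p-1)/3}\left(\frac{27}{d}\right)^{(p-1)/2}}{4\binom{p-1}{(5p-5)/6}}\left(p+3p^2-\frac{p^3}{6}\left(\frac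 p3\right)B_{p-2}\left(\frac16\right)\right)\pmod{p^4}&\text{if }p\equiv1\pmod 3,\\[2mm]-\frac32\left(-\frac{27}{d}\right)^{(p-1)/2}p\binom{(7p+1)/6}{p+1}\pmod{p^2}&\text{if }p\equiv2\pmod 3;\end{cases}$$ $$\sum_{k=0}^{(p-1)/2}\left(1+\tfrac{16-d}{3}k^2+\tfrac{32+d}{6}k\right)\frac{\binom{4k}{2k}}{d^k}\equiv\begin{cases}\dfrac{(-1)^{(p-1)/4}\left(\frac{64}{d}\right)^{(p-1)/2}}{3\binom{p-1}{(3p-3)/4}}\left(p+2p^2-(-1)^{(p-1)/2}p^3E_{p-3}\right)\pmod{p^4}&\text{if }p\equiv1\pmod 4,\\[2mm]-\frac43\left(-\frac{64}{d}\right)^{(p-1)/2}p\binom{(5p+1)/4}{p+1}\pmod{p^2}&\text{if }p\equiv3\pmod 4;\end{cases}$$ $$\sum_{k=0}^{(p-1)/2}\left(1+\tfrac{108-d}{15}k^2+\tfrac{216+d}{30}k\right)\frac{\binom{6k}{3k}\binom{3k}{k}}{d^k\binom{2k}{k}}\equiv\begin{cases}\dfrac{(-1)^{(p-1)/6}\left(\frac{432}{d}\right)^{(p-1)/2}}{5\binom{p-1}{(2p-2)/3}}\left(2p+3p^2-\frac{p^3}{30}\left(\frac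 p3\right)B_{p-2}\left(\frac16\right)\right)\pmod{p^4}&\text{if }p\equiv1\pmod 6,\\[2mm]-\frac65\left(-\frac{432}{d}\right)^{(p-1)/2}p\binom{(4p+1)/3}{p+1}\pmod{p^2}&\text{if }p\equiv5\pmod 6\text{ and }p\neq5.\end{cases}$$ -/

import Mathlib

/-- The congruence `a ≡ b (mod p ^ n)` of rational numbers, read `p`-adically: the difference
`a - b` is `p ^ n` times a rational number whose reduced denominator is prime to `p`. -/
def PadicCongr (p n : ℕ) (a b : ℚ) : Prop :=
  ∃ c : ℚ, ¬ p ∣ c.den ∧ a - b = (p : ℚ) ^ n * c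

/-- The Fermat quotient `q_p(a) = (a ^ (p - 1) - 1) / p`. -/
def fermatQuotient (p : ℕ) (a : ℤ) : ℚ :=
  ((a : ℚ) ^ (p - 1) - 1) / (p : ℚ)

/-- The Euler numbers, by their exponential generating function
`2 * exp t / (exp (2 * t) + 1) = ∑ E_n * t ^ n / n!`, as formal power series over `ℚ`
(the constant coefficient of the denominator is `2`, so the inverse is the true inverse). -/
noncomputable def eulerNumber (n : ℕ) : ℚ :=
  (n.factorial : ℚ) *
    PowerSeries.coeff n
      (2 * PowerSeries.exp ℚ * (PowerSeries.rescale (2 : ℚ) (PowerSeries.exp ℚ) + 1)⁻¹)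

/-! Each sum telescopes. If c_k is the binomial factor and its ratio recurrence reads P(n) c_n =
R(n+1) c_{n+1}, then the quadratic coefficient of c_k / d^k is exactly P(k) - d R(k), so the sum up
to n equals P(n) c_n / d^n for every d ≠ 0. At n = (p-1)/2, where 2n + 1 = p, a factor p (p^2 in the
first case) comes out. What is left are the binomials C(p-1, n), C(p+n, n), C(2p-1, p-1) and C(3p-1,
p-1), all needed modulo p^3.

These, and the binomials C(p-1, (p-1)/N) in the denominators of the claims, are values of F_{N,c}(x)
= ∏ (1 + xp/r) over 0 < r < p with r ≡ c mod N (`classProd`). Modulo p^3 such products obey a few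
rules: F(x)F(y) = F(x+y)(1 + xy p^2 ∑ 1/r^2) (`classProd_mul`); r ↦ p - r exchanges classes
(`classProd_reflect`); multiplication by N permutes the residues and expresses N^(p-1) through the
classes (`pow_eq_prod_classProd`); F_{N,0}(xN) is a binomial coefficient up to sign
(`classProd_zero_mul`). Solving these relations for N = 1, 2, 4, 3, 6 gives Wolstenholme, Morley,
`choose_quarter`, `choose_third` and `choose_sixth`. For N = 3, 6 only a square is determined; its
root is singled out by being 1 modulo p, which rests on the quadratic character of -3.

The p^2 corrections involve S = ∑ i^(p-3) over i ≤ (p-1)/N modulo p. Faulhaber's formula gives 2S ≡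
B_{p-2}(1/N), and for N = 4 a generating function identity turns this into Euler numbers.

In the remaining residue classes the claim is only modulo p^2. There Lucas' theorem evaluates the
binomial on the right modulo p, and a quadratic character supplies the sign. -/

/-- The product of `1 + x * p / r` over the residues `0 < r < p` with `r % N = c`, in `ZMod (p ^ 3)`. -/
def classProd (p N c : ℕ) (x : ℤ) : ZMod (p ^ 3) :=
  ∏ r ∈ (Finset.Ico 1 p).filter (fun r => r % N = c),
    (1 + (x : ZMod (p ^ 3)) * (p : ZMod (p ^ 3)) * (r : ZMod (p ^ 3))⁻¹)

/-- The sum of `r ^ (p - 3)` over the residues `0 < r < p` with `r % N = c`. -/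
def classSum (p N c : ℕ) : ℕ :=
  ∑ r ∈ (Finset.Ico 1 p).filter (fun r => r % N = c), r ^ (p - 3)

/-! ### Products and power sums over residue classes, modulo p^3 -/

section Basic

variable {p : ℕ}

theorem cast_prime_cube (p : ℕ) : (p : ZMod (p ^ 3)) ^ 3 = 0 := by
  have := ZMod.natCast_self (p ^ 3)
  push_cast at this
  exact this

theorem natCast_mul_inv_of_lt (hp : p.Prime) {r : ℕ} (h0 : 0 < r) (hr : r < p) :
    (r : ZMod (p ^ 3)) * (r : ZMod (p ^ 3))⁻¹ = 1 := by
  apply ZMod.coe_mul_inv_eq_one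
  exact Nat.Coprime.pow_right 3 (Nat.coprime_of_lt_prime h0.ne' hr hp).symm

theorem isUnit_one_add_prime_mul (y : ZMod (p ^ 3)) : IsUnit (1 + (p : ZMod (p ^ 3)) * y) := by
  apply IsNilpotent.isUnit_one_add
  exact ⟨3, by rw [mul_pow, cast_prime_cube, zero_mul]⟩

/-- Coefficients of p^2 only matter modulo p: every relation between power sums is proved in `ZMod
p` and enters the computations modulo p^3 through this lemma. -/
theorem sq_mul_intCast_eq_zero {z : ℤ} (hz : (z : ZMod p) = 0) :
    (p : ZMod (p ^ 3)) ^ 2 * (z : ZMod (p ^ 3)) = 0 := by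
  obtain ⟨k, rfl⟩ := (ZMod.intCast_zmod_eq_zero_iff_dvd z p).1 hz
  have := cast_prime_cube p
  push_cast
  linear_combination (k : ZMod (p ^ 3)) * this

theorem sq_mul_inv_sq (hp : p.Prime) (hp3 : 3 < p) {r : ℕ} (h0 : 0 < r) (hr : r < p) :
    (p : ZMod (p ^ 3)) ^ 2 * ((r : ZMod (p ^ 3))⁻¹) ^ 2 =
      (p : ZMod (p ^ 3)) ^ 2 * (r : ZMod (p ^ 3)) ^ (p - 3) := by
  have := Fact.mk hp
  have hz : (((r : ℤ) ^ (p - 1) - 1 : ℤ) : ZMod p) = 0 := by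
    push_cast
    rw [ZMod.pow_card_sub_one_eq_one, sub_self]
    intro h
    rw [ZMod.natCast_eq_zero_iff] at h
    exact absurd (Nat.le_of_dvd h0 h) (by omega)
  have h := sq_mul_intCast_eq_zero hz
  push_cast at h
  have hu := natCast_mul_inv_of_lt hp h0 hr
  have he : p - 1 = (p - 3) + 2 := by omega
  rw [he, pow_add] at h
  have hu2 : (r : ZMod (p ^ 3)) ^ 2 * ((r : ZMod (p ^ 3))⁻¹) ^ 2 = 1 := by
    rw [← mul_pow, hu, one_pow]
  linear_combination -((r : ZMod (p ^ 3))⁻¹) ^ 2 * h +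
    (p : ZMod (p ^ 3)) ^ 2 * (r : ZMod (p ^ 3)) ^ (p - 3) * hu2

/-- Factor by factor, (1 + xp/r)(1 + yp/r) = 1 + (x+y)p/r + xy p^2/r^2. The last term can be split
off multiplicatively because p^3 = 0, and Fermat replaces 1/r^2 by r^(p-3). -/
theorem prod_one_add_mul_prod_one_add (hp : p.Prime) (hp3 : 3 < p) (x y : ℤ) (s : Finset ℕ)
    (hs : ∀ r ∈ s, 0 < r ∧ r < p) :
    (∏ r ∈ s, (1 + (x : ZMod (p ^ 3)) * p * (r : ZMod (p ^ 3))⁻¹)) *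
      (∏ r ∈ s, (1 + (y : ZMod (p ^ 3)) * p * (r : ZMod (p ^ 3))⁻¹)) =
    (∏ r ∈ s, (1 + ((x + y : ℤ) : ZMod (p ^ 3)) * p * (r : ZMod (p ^ 3))⁻¹)) *
      (1 + x * y * p ^ 2 * (∑ r ∈ s, r ^ (p - 3) : ℕ)) := by
  induction s using Finset.induction_on with
  | empty => simp
  | insert a s ha ih =>
    have ih := ih fun r hr => hs r (Finset.mem_insert_of_mem hr)
    obtain ⟨h0, hr⟩ := hs a (Finset.mem_insert_self a s)
    rw [Finset.prod_insert ha, Finset.prod_insert ha, Finset.prod_insert ha, Finset.sum_insert ha]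
    have hsq := sq_mul_inv_sq hp hp3 h0 hr
    have hc := cast_prime_cube p
    generalize (∏ r ∈ s, (1 + (x : ZMod (p ^ 3)) * p * (r : ZMod (p ^ 3))⁻¹)) = X at *
    generalize (∏ r ∈ s, (1 + (y : ZMod (p ^ 3)) * p * (r : ZMod (p ^ 3))⁻¹)) = Y at *
    generalize (∏ r ∈ s, (1 + ((x + y : ℤ) : ZMod (p ^ 3)) * p * (r : ZMod (p ^ 3))⁻¹)) = Z at *
    push_cast
    generalize hS : (∑ r ∈ s, (r : ZMod (p ^ 3)) ^ (p - 3)) = S at *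
    push_cast at ih
    rw [hS] at ih
    generalize (a : ZMod (p ^ 3)) ^ (p - 3) = b at *
    generalize (a : ZMod (p ^ 3))⁻¹ = u at *
    generalize (x : ZMod (p ^ 3)) = x at *
    generalize (y : ZMod (p ^ 3)) = y at *
    generalize (p : ZMod (p ^ 3)) = q at *
    linear_combination (1 + x * q * u) * (1 + y * q * u) * ih
      + (x * y * Z * (1 + x * y * q ^ 2 * S)) * hsq
      + Z * x * y * (x * y * b * q * S - (x + y) * u * b) * hc

theorem classProd_mul (hp : p.Prime) (hp3 : 3 < p) (N c : ℕ) (x y : ℤ) :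
    classProd p N c x * classProd p N c y =
      classProd p N c (x + y) * (1 + x * y * p ^ 2 * classSum p N c) := by
  apply prod_one_add_mul_prod_one_add hp hp3
  intro r hr
  simp only [Finset.mem_filter, Finset.mem_Ico] at hr
  omega

theorem classProd_zero (N c : ℕ) : classProd p N c 0 = 1 := by
  simp [classProd]

theorem exists_prod_one_add_eq (s : Finset ℕ) (f : ℕ → ZMod (p ^ 3)) (x : ZMod (p ^ 3)) :
    ∃ y, ∏ r ∈ s, (1 + x * (p : ZMod (p ^ 3)) * f r) = 1 + (p : ZMod (p ^ 3)) * y := by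
  induction s using Finset.induction_on with
  | empty => exact ⟨0, by simp⟩
  | insert a s ha ih =>
    obtain ⟨y, hy⟩ := ih
    rw [Finset.prod_insert ha, hy]
    exact ⟨x * f a + y + x * f a * (p : ZMod (p ^ 3)) * y, by ring⟩

theorem exists_classProd_eq (N c : ℕ) (x : ℤ) :
    ∃ y, classProd p N c x = 1 + (p : ZMod (p ^ 3)) * y :=
  exists_prod_one_add_eq _ _ _

theorem isUnit_classProd (N c : ℕ) (x : ℤ) : IsUnit (classProd p N c x) := by
  obtain ⟨y, hy⟩ := exists_classProd_eq (p := p) N c x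
  rw [hy]
  exact isUnit_one_add_prime_mul y

/-- Substituting r ↦ p - r, the identity (1 + xp/(p-r))(1 - p/r) = 1 - (1+x)p/r holds for each
factor. -/
theorem classProd_reflect (hp : p.Prime) {N c c' : ℕ} (x : ℤ)
    (h : ∀ r, 0 < r → r < p → (r % N = c ↔ (p - r) % N = c')) :
    classProd p N c' x * classProd p N c (-1) = classProd p N c (-1 - x) := by
  have h1 : classProd p N c' x =
      ∏ r ∈ (Finset.Ico 1 p).filter (fun r => r % N = c),
        (1 + (x : ZMod (p ^ 3)) * p * ((p - r : ℕ) : ZMod (p ^ 3))⁻¹) := by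
    refine Finset.prod_nbij' (fun r => p - r) (fun r => p - r) ?_ ?_ ?_ ?_ ?_
    · intro r hr
      simp only [Finset.mem_filter, Finset.mem_Ico] at hr ⊢
      refine ⟨by omega, (h (p - r) (by omega) (by omega)).2 ?_⟩
      rw [Nat.sub_sub_self (by omega)]
      exact hr.2
    · intro r hr
      simp only [Finset.mem_filter, Finset.mem_Ico] at hr ⊢
      exact ⟨by omega, (h r (by omega) (by omega)).1 hr.2⟩
    · intro r hr
      simp only [Finset.mem_filter, Finset.mem_Ico] at hr
      omega
    · intro r hr
      simp only [Finset.mem_filter, Finset.mem_Ico] at hr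
      omega
    · intro r hr
      simp only [Finset.mem_filter, Finset.mem_Ico] at hr
      rw [Nat.sub_sub_self (by omega)]
  rw [h1, classProd, classProd, ← Finset.prod_mul_distrib]
  refine Finset.prod_congr rfl fun r hr => ?_
  simp only [Finset.mem_filter, Finset.mem_Ico] at hr
  have hu := natCast_mul_inv_of_lt hp (show 0 < r by omega) (by omega)
  have hv := natCast_mul_inv_of_lt hp (show 0 < p - r by omega) (by omega)
  rw [Nat.cast_sub (by omega)] at hv ⊢
  push_cast
  generalize (r : ZMod (p ^ 3))⁻¹ = u at *
  generalize ((p : ZMod (p ^ 3)) - r)⁻¹ = v at *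
  linear_combination -(x : ZMod (p ^ 3)) * p * u * hv - (x : ZMod (p ^ 3)) * p * v * hu

theorem classProd_split {N M c : ℕ} (C : Finset ℕ) (x : ℤ)
    (h : ∀ r, r % N = c ↔ r % M ∈ C) :
    classProd p N c x = ∏ c' ∈ C, classProd p M c' x := by
  unfold classProd
  rw [← Finset.prod_fiberwise_of_maps_to (g := fun r => r % M) (t := C)]
  · refine Finset.prod_congr rfl fun c' hc' => ?_
    refine Finset.prod_congr ?_ fun _ _ => rfl
    ext r
    simp only [Finset.mem_filter, h]
    constructor
    · tauto
    · rintro ⟨h1, h2⟩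
      exact ⟨⟨h1, h2 ▸ hc'⟩, h2⟩
  · intro r hr
    exact (h r).1 (Finset.mem_filter.1 hr).2

theorem classSum_split {N M c : ℕ} (C : Finset ℕ)
    (h : ∀ r, r % N = c ↔ r % M ∈ C) :
    classSum p N c = ∑ c' ∈ C, classSum p M c' := by
  unfold classSum
  rw [← Finset.sum_fiberwise_of_maps_to (g := fun r => r % M) (t := C)]
  · refine Finset.sum_congr rfl fun c' hc' => ?_
    refine Finset.sum_congr ?_ fun _ _ => rfl
    ext r
    simp only [Finset.mem_filter, h]
    constructor
    · tauto
    · rintro ⟨h1, h2⟩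
      exact ⟨⟨h1, h2 ▸ hc'⟩, h2⟩
  · intro r hr
    exact (h r).1 (Finset.mem_filter.1 hr).2

theorem classSum_reflect {N c c' : ℕ} (hp : p.Prime) (hp3 : 3 < p)
    (h : ∀ r, 0 < r → r < p → (r % N = c ↔ (p - r) % N = c')) :
    (classSum p N c' : ZMod p) = classSum p N c := by
  have hev : Even (p - 3) := by
    have := hp.odd_of_ne_two (by omega)
    rcases this with ⟨k, hk⟩
    exact ⟨k - 1, by omega⟩
  unfold classSum
  push_cast
  refine Finset.sum_nbij' (fun r => p - r) (fun r => p - r) ?_ ?_ ?_ ?_ ?_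
  · intro r hr
    simp only [Finset.mem_filter, Finset.mem_Ico] at hr ⊢
    refine ⟨by omega, (h (p - r) (by omega) (by omega)).2 ?_⟩
    rw [Nat.sub_sub_self (by omega)]
    exact hr.2
  · intro r hr
    simp only [Finset.mem_filter, Finset.mem_Ico] at hr ⊢
    exact ⟨by omega, (h r (by omega) (by omega)).1 hr.2⟩
  · intro r hr
    simp only [Finset.mem_filter, Finset.mem_Ico] at hr
    omega
  · intro r hr
    simp only [Finset.mem_filter, Finset.mem_Ico] at hr
    omega
  · intro r hr
    simp only [Finset.mem_filter, Finset.mem_Ico] at hr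
    rw [Nat.cast_sub (by omega), ZMod.natCast_self, zero_sub, hev.neg_pow]

theorem classSum_one_zero (hp : p.Prime) (hp3 : 3 < p) : (classSum p 1 0 : ZMod p) = 0 := by
  have := Fact.mk hp
  have h := FiniteField.sum_pow_lt_card_sub_one (ZMod p) (p - 3) (by rw [ZMod.card]; omega)
  rw [← h]
  unfold classSum
  push_cast
  have h2 : ∑ x : ZMod p, x ^ (p - 3) = ∑ r ∈ Finset.range p, (r : ZMod p) ^ (p - 3) := by
    refine Finset.sum_nbij' (fun x => x.val) (fun r => (r : ZMod p)) ?_ ?_ ?_ ?_ ?_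
    · intro x _; exact Finset.mem_range.2 (ZMod.val_lt x)
    · intro r _; exact Finset.mem_univ _
    · intro x _; exact ZMod.natCast_zmod_val x
    · intro r hr; exact ZMod.val_cast_of_lt (Finset.mem_range.1 hr)
    · intro x _; rw [ZMod.natCast_zmod_val]
  rw [h2, Finset.range_eq_Ico, Finset.sum_eq_sum_Ico_succ_bot hp.pos]
  simp only [Nat.cast_zero, zero_pow (show p - 3 ≠ 0 by omega), zero_add]
  refine Finset.sum_congr ?_ fun _ _ => rfl
  ext r
  simp [Nat.mod_one]

theorem isUnit_prod_Ico (hp : p.Prime) :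
    IsUnit (∏ r ∈ Finset.Ico 1 p, (r : ZMod (p ^ 3))) := by
  refine IsUnit.prod_iff.2 fun r hr => ?_
  rw [Finset.mem_Ico] at hr
  exact IsUnit.of_mul_eq_one _ (natCast_mul_inv_of_lt hp (by omega) hr.2)

/-- Gauss' argument: j ↦ Nj permutes the nonzero residues modulo p, so N^(p-1) (p-1)! is the product
of the numbers Nj = r + kp. Dividing by (p-1)! = ∏ r leaves the factors 1 + kp/r. -/
theorem pow_eq_prod_one_add (hp : p.Prime) {N : ℕ} (hN : 1 < N) (hpN : p % N = 1) :
    (N : ZMod (p ^ 3)) ^ (p - 1) = ∏ r ∈ Finset.Ico 1 p,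
      (1 + (((N - r % N) % N : ℕ) : ZMod (p ^ 3)) * p * (r : ZMod (p ^ 3))⁻¹) := by
  have hNp : N < p := by
    by_contra hlt
    rcases Nat.lt_or_ge p N with h | h
    · rw [Nat.mod_eq_of_lt h] at hpN
      exact hp.one_lt.ne' hpN
    · have : p = N := by omega
      rw [this, Nat.mod_self] at hpN
      omega
  have hcop : Nat.Coprime p N := Nat.coprime_of_lt_prime (by omega) hNp hp
  have hkey : ∏ r ∈ Finset.Ico 1 p, (r + ((N - r % N) % N) * p) = ∏ j ∈ Finset.Ico 1 p, (N * j) := by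
    symm
    refine Finset.prod_nbij (fun j => (N * j) % p) ?_ ?_ ?_ ?_
    · intro j hj
      rw [Finset.mem_Ico] at hj ⊢
      refine ⟨Nat.pos_of_ne_zero fun h0 => ?_, Nat.mod_lt _ hp.pos⟩
      have := hcop.dvd_of_dvd_mul_left (Nat.dvd_of_mod_eq_zero h0)
      exact absurd (Nat.le_of_dvd (by omega) this) (by omega)
    · intro i hi j hj hij
      rw [Finset.mem_coe, Finset.mem_Ico] at hi hj
      have h1 : N * i ≡ N * j [MOD p] := hij
      have h2 := Nat.ModEq.cancel_left_of_coprime hcop h1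
      exact Nat.ModEq.eq_of_lt_of_lt h2 hi.2 hj.2
    · have hmaps : ∀ j ∈ Finset.Ico 1 p, (N * j) % p ∈ Finset.Ico 1 p := by
        intro j hj
        rw [Finset.mem_Ico] at hj ⊢
        refine ⟨Nat.pos_of_ne_zero fun h0 => ?_, Nat.mod_lt _ hp.pos⟩
        have := hcop.dvd_of_dvd_mul_left (Nat.dvd_of_mod_eq_zero h0)
        exact absurd (Nat.le_of_dvd (by omega) this) (by omega)
      refine Finset.surjOn_of_injOn_of_card_le _ hmaps ?_ le_rfl
      intro i hi j hj hij
      rw [Finset.mem_coe, Finset.mem_Ico] at hi hj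
      have h1 : N * i ≡ N * j [MOD p] := hij
      have h2 := Nat.ModEq.cancel_left_of_coprime hcop h1
      exact Nat.ModEq.eq_of_lt_of_lt h2 hi.2 hj.2
    · intro j hj
      rw [Finset.mem_Ico] at hj
      have hdiv := Nat.mod_add_div (N * j) p
      set r := (N * j) % p with hr
      set k := (N * j) / p with hk
      -- Here k = ⌊Nj/p⌋ < N. As N divides r + pk and p ≡ 1 mod N, it divides r + k, so k is the
      -- least nonnegative residue of -r modulo N.
      have hkN : k < N := by
        rw [hk, Nat.div_lt_iff_lt_mul hp.pos]
        exact Nat.mul_lt_mul_of_pos_left hj.2 (by omega)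
      have hmod : (r + k) % N = 0 := by
        have h1 : (r + p * k) % N = 0 := by rw [hdiv]; exact Nat.mul_mod_right N j
        rw [Nat.add_mod, Nat.mul_mod, hpN, one_mul, Nat.mod_mod, ← Nat.add_mod] at h1
        exact h1
      have hkk : (N - r % N) % N = k := by
        have hlt := Nat.mod_lt r (show 0 < N by omega)
        rw [Nat.add_mod, Nat.mod_eq_of_lt hkN] at hmod
        rcases Nat.eq_zero_or_pos (r % N) with h | h
        · rw [h] at hmod ⊢
          rw [zero_add, Nat.mod_eq_of_lt hkN] at hmod
          simp [hmod]
        · rw [Nat.mod_eq_of_lt (show N - r % N < N by omega)]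
          have hd := Nat.dvd_of_mod_eq_zero hmod
          obtain ⟨t, ht⟩ := hd
          have : t = 1 := by
            have h3 : N * t < N * 2 := by omega
            have h4 : t < 2 := lt_of_mul_lt_mul_left h3 (Nat.zero_le N)
            have ht0 : t ≠ 0 := by
              rintro rfl
              rw [mul_zero] at ht
              exact absurd (Nat.eq_zero_of_add_eq_zero_right ht) h.ne'
            omega
          subst this
          omega
      rw [hkk]
      rw [← hdiv]
      ring
  have hcast := congrArg (fun n : ℕ => (n : ZMod (p ^ 3))) hkey
  simp only [Nat.cast_prod] at hcast
  refine (isUnit_prod_Ico hp).mul_left_cancel ?_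
  rw [← Finset.prod_mul_distrib]
  trans ∏ j ∈ Finset.Ico 1 p, ((N * j : ℕ) : ZMod (p ^ 3))
  · simp only [Nat.cast_mul, Finset.prod_mul_distrib, Finset.prod_const, Nat.card_Ico]
    ring
  · rw [← hcast]
    refine Finset.prod_congr rfl fun r hr => ?_
    rw [Finset.mem_Ico] at hr
    have hu := natCast_mul_inv_of_lt hp (show 0 < r by omega) hr.2
    push_cast
    linear_combination -(((N - r % N) % N : ℕ) : ZMod (p ^ 3)) * p * hu

theorem pow_eq_prod_classProd (hp : p.Prime) {N : ℕ} (hN : 1 < N) (hpN : p % N = 1) :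
    (N : ZMod (p ^ 3)) ^ (p - 1) =
      ∏ c ∈ Finset.range N, classProd p N c (((N - c) % N : ℕ) : ℤ) := by
  rw [pow_eq_prod_one_add hp hN hpN,
    ← Finset.prod_fiberwise_of_maps_to (g := fun r => r % N) (t := Finset.range N)]
  · refine Finset.prod_congr rfl fun c hc => ?_
    unfold classProd
    refine Finset.prod_congr rfl fun r hr => ?_
    rw [(Finset.mem_filter.1 hr).2]
    rw [Int.cast_natCast]
  · intro r _
    exact Finset.mem_range.2 (Nat.mod_lt _ (by omega))

/-- In (x - y)(x + y) = 0 the second factor is 2 plus a multiple of p, hence a unit. -/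
theorem eq_of_sq_eq_sq_of_eq_one_add (hp : p.Prime) (hp3 : 3 < p) {x y a b : ZMod (p ^ 3)}
    (hx : x = 1 + (p : ZMod (p ^ 3)) * a) (hy : y = 1 + (p : ZMod (p ^ 3)) * b) (h : x ^ 2 = y ^ 2) : x = y := by
  have h2 : IsUnit (x + y) := by
    have hu := natCast_mul_inv_of_lt hp (show 0 < 2 by omega) (by omega)
    have : x + y = ((2 : ℕ) : ZMod (p ^ 3)) * (1 + (p : ZMod (p ^ 3)) * (((2 : ℕ) : ZMod (p ^ 3))⁻¹ * (a + b))) := by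
      rw [hx, hy]
      push_cast at hu ⊢
      linear_combination (-(p : ZMod (p ^ 3)) * (a + b)) * hu
    rw [this]
    exact (IsUnit.of_mul_eq_one _ hu).mul (isUnit_one_add_prime_mul _)
  have h3 : (x + y) * x = (x + y) * y := by linear_combination h
  exact h2.mul_left_cancel h3

end Basic

/-! ### Binomial coefficients as class products; Wolstenholme and Morley -/

section Binomials

variable {p : ℕ}

theorem prod_one_add_div_eq_choose (hp : p.Prime) (x : ℕ) {m : ℕ} (hm : m < p) :
    ∏ i ∈ Finset.Ico 1 (m + 1), (1 + (x : ZMod (p ^ 3)) * p * (i : ZMod (p ^ 3))⁻¹) =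
      ((x * p + m).choose m : ZMod (p ^ 3)) := by
  induction m with
  | zero => simp
  | succ m ih =>
    have hu := natCast_mul_inv_of_lt hp (Nat.succ_pos m) hm
    rw [Finset.prod_Ico_succ_top (by omega), ih (by omega)]
    have h := congrArg (fun n : ℕ => (n : ZMod (p ^ 3))) (Nat.add_one_mul_choose_eq (x * p + m) m)
    push_cast at h hu ⊢
    rw [← add_assoc]
    generalize ((m : ZMod (p ^ 3)) + 1)⁻¹ = u at *
    generalize ((x * p + m + 1).choose (m + 1) : ZMod (p ^ 3)) = C at *
    linear_combination u * h + (C - ((x * p + m).choose m : ZMod (p ^ 3))) * hu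

theorem prod_one_sub_div_eq_choose (hp : p.Prime) {m : ℕ} (hm : m < p) :
    ∏ i ∈ Finset.Ico 1 (m + 1),
      (1 + ((-1 : ℤ) : ZMod (p ^ 3)) * p * (i : ZMod (p ^ 3))⁻¹) =
      (-1) ^ m * ((p - 1).choose m : ZMod (p ^ 3)) := by
  induction m with
  | zero => simp
  | succ m ih =>
    have hu := natCast_mul_inv_of_lt hp (Nat.succ_pos m) hm
    rw [Finset.prod_Ico_succ_top (by omega), ih (by omega)]
    have h := congrArg (fun n : ℕ => (n : ZMod (p ^ 3))) (Nat.choose_succ_right_eq (p - 1) m)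
    have h1 : p - 1 - m = p - (m + 1) := by omega
    rw [h1] at h
    push_cast [Nat.cast_sub hm.le] at h hu ⊢
    rw [pow_succ (-1 : ZMod (p ^ 3))]
    generalize ((m : ZMod (p ^ 3)) + 1)⁻¹ = u at *
    generalize ((p - 1).choose (m + 1) : ZMod (p ^ 3)) = C at *
    linear_combination ((-1) ^ m * u) * h -
      (-1) ^ m * (C + ((p - 1).choose m : ZMod (p ^ 3))) * hu

/-- The residues divisible by N are r = Ni with 1 ≤ i ≤ m = ⌊(p-1)/N⌋, and the N in the argument
cancels the one in r. With the two preceding products this yields C(xp+m, m) and, for x = -1, (-1)^m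
C(p-1, m). -/
theorem classProd_zero_mul (hp : p.Prime) {N m : ℕ} (hN : 0 < N) (h1 : N * m < p)
    (h2 : p ≤ N * (m + 1)) (x : ℤ) :
    classProd p N 0 (x * N) =
      ∏ i ∈ Finset.Ico 1 (m + 1), (1 + (x : ZMod (p ^ 3)) * p * (i : ZMod (p ^ 3))⁻¹) := by
  unfold classProd
  symm
  refine Finset.prod_nbij' (fun i => N * i) (fun r => r / N) ?_ ?_ ?_ ?_ ?_
  · intro i hi
    simp only [Finset.mem_filter, Finset.mem_Ico] at hi ⊢
    refine ⟨⟨Nat.mul_pos hN (by omega), ?_⟩, Nat.mul_mod_right N i⟩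
    exact lt_of_le_of_lt (Nat.mul_le_mul_left N (by omega)) h1
  · intro r hr
    simp only [Finset.mem_filter, Finset.mem_Ico] at hr ⊢
    refine ⟨Nat.div_pos (Nat.le_of_dvd (by omega) (Nat.dvd_of_mod_eq_zero hr.2)) hN, ?_⟩
    rw [Nat.div_lt_iff_lt_mul hN, mul_comm]
    omega
  · intro i _
    exact Nat.mul_div_cancel_left i hN
  · intro r hr
    exact Nat.mul_div_cancel' (Nat.dvd_of_mod_eq_zero (Finset.mem_filter.1 hr).2)
  · intro i hi
    rw [Finset.mem_Ico] at hi
    have hlt : N * i < p := lt_of_le_of_lt (Nat.mul_le_mul_left N (by omega)) h1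
    have hu := natCast_mul_inv_of_lt hp (show 0 < i by omega)
      (lt_of_le_of_lt (Nat.le_mul_of_pos_left i hN) hlt)
    have hv := natCast_mul_inv_of_lt hp (Nat.mul_pos hN (show 0 < i by omega)) hlt
    push_cast at hv ⊢
    generalize (i : ZMod (p ^ 3))⁻¹ = u at *
    generalize ((N : ZMod (p ^ 3)) * i)⁻¹ = v at *
    linear_combination (x : ZMod (p ^ 3)) * p * N * v * hu - (x : ZMod (p ^ 3)) * p * u * hv

theorem classSum_zero_eq (hp3 : 3 < p) {N m : ℕ} (hN : 0 < N) (h1 : N * m < p)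
    (h2 : p ≤ N * (m + 1)) :
    classSum p N 0 = N ^ (p - 3) * ∑ i ∈ Finset.range (m + 1), i ^ (p - 3) := by
  unfold classSum
  rw [Finset.range_eq_Ico, Finset.sum_eq_sum_Ico_succ_bot (by omega),
    zero_pow (show p - 3 ≠ 0 by omega), zero_add, Finset.mul_sum]
  symm
  refine Finset.sum_nbij' (fun i => N * i) (fun r => r / N) ?_ ?_ ?_ ?_ ?_
  · intro i hi
    simp only [Finset.mem_filter, Finset.mem_Ico] at hi ⊢
    refine ⟨⟨Nat.mul_pos hN (by omega), ?_⟩, Nat.mul_mod_right N i⟩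
    exact lt_of_le_of_lt (Nat.mul_le_mul_left N (by omega)) h1
  · intro r hr
    simp only [Finset.mem_filter, Finset.mem_Ico] at hr ⊢
    refine ⟨Nat.div_pos (Nat.le_of_dvd (by omega) (Nat.dvd_of_mod_eq_zero hr.2)) hN, ?_⟩
    rw [Nat.div_lt_iff_lt_mul hN, mul_comm]
    omega
  · intro i _
    exact Nat.mul_div_cancel_left i hN
  · intro r hr
    exact Nat.mul_div_cancel' (Nat.dvd_of_mod_eq_zero (Finset.mem_filter.1 hr).2)
  · intro i _
    rw [mul_pow]

theorem natCast_ne_zero_of_lt {r : ℕ} (h0 : 0 < r) (hr : r < p) :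
    (r : ZMod p) ≠ 0 := by
  intro h
  rw [ZMod.natCast_eq_zero_iff] at h
  exact absurd (Nat.le_of_dvd h0 h) (by omega)

theorem sq_mul_pow_sub_three (hp : p.Prime) (hp3 : 3 < p) {N : ℕ} (h0 : 0 < N) (hN : N < p) :
    (N : ZMod p) ^ 2 * (N : ZMod p) ^ (p - 3) = 1 := by
  have := Fact.mk hp
  rw [← pow_add, show 2 + (p - 3) = p - 1 by omega]
  exact ZMod.pow_card_sub_one_eq_one (natCast_ne_zero_of_lt h0 hN)

theorem sq_mul_classSum_zero (hp : p.Prime) (hp3 : 3 < p) {N m : ℕ} (hN : 0 < N) (hNp : N < p)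
    (h1 : N * m < p) (h2 : p ≤ N * (m + 1)) :
    (N : ZMod p) ^ 2 * (classSum p N 0 : ZMod p) =
      ((∑ i ∈ Finset.range (m + 1), i ^ (p - 3) : ℕ) : ZMod p) := by
  rw [classSum_zero_eq hp3 hN h1 h2]
  have := sq_mul_pow_sub_three hp hp3 hN hNp
  push_cast
  linear_combination (∑ i ∈ Finset.range (m + 1), (i : ZMod p) ^ (p - 3)) * this

/-- For N = 1 reflection preserves the only class, and at x = -1 it says that the square of this
product is F(0) = 1. -/
theorem classProd_one_zero_neg_one (hp : p.Prime) (hp3 : 3 < p) : classProd p 1 0 (-1) = 1 := by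
  have h := classProd_reflect (p := p) (N := 1) (c := 0) (c' := 0) hp (-1)
    (fun r _ _ => by simp [Nat.mod_one])
  rw [show (-1 - -1 : ℤ) = 0 by ring, classProd_zero] at h
  obtain ⟨y, hy⟩ := exists_classProd_eq (p := p) 1 0 (-1)
  exact eq_of_sq_eq_sq_of_eq_one_add hp hp3 hy (b := 0) (by ring) (by rw [sq, h, one_pow])

theorem classProd_one_zero_add (hp : p.Prime) (hp3 : 3 < p) (x y : ℤ) :
    classProd p 1 0 x * classProd p 1 0 y = classProd p 1 0 (x + y) := by
  rw [classProd_mul hp hp3]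
  have h := sq_mul_intCast_eq_zero (p := p) (z := (classSum p 1 0 : ℤ))
    (by rw [Int.cast_natCast]; exact classSum_one_zero hp hp3)
  rw [Int.cast_natCast] at h
  linear_combination (classProd p 1 0 (x + y) * x * y) * h

theorem classProd_one_zero_one (hp : p.Prime) (hp3 : 3 < p) : classProd p 1 0 1 = 1 := by
  have h := classProd_one_zero_add hp hp3 (-1) 1
  rw [classProd_one_zero_neg_one hp hp3, one_mul] at h
  rw [h]
  exact classProd_zero 1 0

theorem classProd_one_zero_two (hp : p.Prime) (hp3 : 3 < p) : classProd p 1 0 2 = 1 := by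
  have h := classProd_one_zero_add hp hp3 1 1
  rw [classProd_one_zero_one hp hp3, one_mul] at h
  exact h.symm

/-- Wolstenholme's theorem. -/
theorem choose_two_mul_sub_one (hp : p.Prime) (hp3 : 3 < p) :
    ((2 * p - 1).choose (p - 1) : ZMod (p ^ 3)) = 1 := by
  have h := prod_one_add_div_eq_choose hp 1 (show p - 1 < p by omega)
  have h2 := classProd_zero_mul hp (N := 1) (m := p - 1) one_pos (by omega) (by omega) 1
  rw [show ((1 : ℤ) * ((1 : ℕ) : ℤ)) = 1 by norm_num, classProd_one_zero_one hp hp3] at h2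
  push_cast at h h2
  rw [h, show 1 * p + (p - 1) = 2 * p - 1 by omega] at h2
  exact h2.symm

theorem choose_three_mul_sub_one (hp : p.Prime) (hp3 : 3 < p) :
    ((3 * p - 1).choose (p - 1) : ZMod (p ^ 3)) = 1 := by
  have h := prod_one_add_div_eq_choose hp 2 (show p - 1 < p by omega)
  have h2 := classProd_zero_mul hp (N := 1) (m := p - 1) one_pos (by omega) (by omega) 2
  rw [show ((2 : ℤ) * ((1 : ℕ) : ℤ)) = 2 by norm_num, classProd_one_zero_two hp hp3] at h2
  push_cast at h h2
  rw [h, show 2 * p + (p - 1) = 3 * p - 1 by omega] at h2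
  exact h2.symm

/-- Reflection exchanges even and odd residues while p - 3 is even, so the two halves of a vanishing
sum agree. Hence F_{2,0} is exactly multiplicative in x. -/
theorem classSum_two_zero (hp : p.Prime) (hp3 : 3 < p) : (classSum p 2 0 : ZMod p) = 0 := by
  have := Fact.mk hp
  have hodd := hp.odd_of_ne_two (by omega)
  rw [Nat.odd_iff] at hodd
  have h1 := classSum_reflect (p := p) (N := 2) (c := 0) (c' := 1) hp hp3 (by intro r h0 hr; omega)
  have h2 := classSum_split (p := p) (N := 1) (M := 2) (c := 0) {0, 1} (by
    intro r; simp only [Finset.mem_insert, Finset.mem_singleton]; omega)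
  have h3 := classSum_one_zero hp hp3
  rw [h2, Finset.sum_pair (by norm_num)] at h3
  push_cast at h3
  have h4 : ((2 : ℕ) : ZMod p) * classSum p 2 0 = 0 := by
    push_cast
    linear_combination h3 - h1
  exact (mul_eq_zero.1 h4).resolve_left (natCast_ne_zero_of_lt (by omega) (by omega))

theorem classProd_two_zero_add (hp : p.Prime) (hp3 : 3 < p) (x y : ℤ) :
    classProd p 2 0 x * classProd p 2 0 y = classProd p 2 0 (x + y) := by
  rw [classProd_mul hp hp3]
  have h := sq_mul_intCast_eq_zero (p := p) (z := (classSum p 2 0 : ℤ))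
    (by rw [Int.cast_natCast]; exact classSum_two_zero hp hp3)
  rw [Int.cast_natCast] at h
  linear_combination (classProd p 2 0 (x + y) * x * y) * h

/-- Here 2^(p-1) = F_{2,1}(1), and reflection gives F_{2,1}(1) F_{2,0}(-1) = F_{2,0}(-2) =
F_{2,0}(-1)^2. -/
theorem classProd_two_zero_neg_one (hp : p.Prime) (hp3 : 3 < p) :
    classProd p 2 0 (-1) = 2 ^ (p - 1) := by
  have hodd := hp.odd_of_ne_two (by omega)
  rw [Nat.odd_iff] at hodd
  have h1 := pow_eq_prod_classProd hp (N := 2) (by omega) hodd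
  rw [Finset.prod_range_succ, Finset.prod_range_succ, Finset.prod_range_zero] at h1
  norm_num at h1
  rw [classProd_zero, one_mul] at h1
  have h2 := classProd_reflect (p := p) (N := 2) (c := 0) (c' := 1) hp 1 (by intro r h0 hr; omega)
  have h3 := classProd_two_zero_add hp hp3 (-1) (-1)
  norm_num at h2 h3
  refine (isUnit_classProd 2 0 (-1)).mul_left_cancel ?_
  rw [h1, h3, ← h2, mul_comm]

theorem classProd_two_zero_neg_two (hp : p.Prime) (hp3 : 3 < p) :
    classProd p 2 0 (-2) = 4 ^ (p - 1) := by
  have h3 := classProd_two_zero_add hp hp3 (-1) (-1)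
  norm_num at h3
  rw [← h3, classProd_two_zero_neg_one hp hp3, ← mul_pow]
  norm_num

theorem classProd_two_zero_two (hp : p.Prime) (hp3 : 3 < p) :
    classProd p 2 0 2 * 4 ^ (p - 1) = 1 := by
  have h3 := classProd_two_zero_add hp hp3 2 (-2)
  norm_num at h3
  rw [← classProd_two_zero_neg_two hp hp3, h3, classProd_zero]

/-- Morley's congruence. -/
theorem choose_half (hp : p.Prime) (hp3 : 3 < p) :
    ((p - 1).choose ((p - 1) / 2) : ZMod (p ^ 3)) = (-1) ^ ((p - 1) / 2) * 4 ^ (p - 1) := by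
  have hodd := hp.odd_of_ne_two (by omega)
  rw [Nat.odd_iff] at hodd
  have h := prod_one_sub_div_eq_choose hp (show (p - 1) / 2 < p by omega)
  rw [← classProd_zero_mul hp (N := 2) (by omega) (by omega) (by omega)] at h
  norm_num at h
  rw [classProd_two_zero_neg_two hp hp3] at h
  rw [h, ← mul_assoc, ← mul_pow]
  norm_num

theorem choose_add_half (hp : p.Prime) (hp3 : 3 < p) :
    ((p + (p - 1) / 2).choose ((p - 1) / 2) : ZMod (p ^ 3)) * 4 ^ (p - 1) = 1 := by
  have hodd := hp.odd_of_ne_two (by omega)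
  rw [Nat.odd_iff] at hodd
  have h := prod_one_add_div_eq_choose hp 1 (show (p - 1) / 2 < p by omega)
  have h2 := classProd_zero_mul hp (N := 2) (m := (p - 1) / 2) (by omega) (by omega) (by omega) 1
  push_cast at h h2
  rw [h, one_mul] at h2
  rw [← h2, classProd_two_zero_two hp hp3]

end Binomials

/-! ### The binomial C(p-1, (p-1)/4) modulo p^3 -/

section Quarter

variable {p : ℕ}

theorem choose_quarter (hp : p.Prime) (hp4 : p % 4 = 1) :
    4 * (-1) ^ ((p - 1) / 4) * ((p - 1).choose ((p - 1) / 4) : ZMod (p ^ 3)) =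
      8 ^ (p - 1) * (4 - (p : ZMod (p ^ 3)) ^ 2 *
        ((∑ i ∈ Finset.range ((p - 1) / 4 + 1), i ^ (p - 3) : ℕ) : ZMod (p ^ 3))) := by
  have := Fact.mk hp
  have hp3 : 3 < p := by have := hp.two_le; omega
  obtain ⟨m, hm⟩ : ∃ m, m = (p - 1) / 4 := ⟨_, rfl⟩
  rw [← hm]
  have hc := cast_prime_cube p
  have hf := prod_one_sub_div_eq_choose hp (show m < p by omega)
  rw [← classProd_zero_mul hp (N := 4) (by omega) (by omega) (by omega)] at hf
  have hs0 := sq_mul_classSum_zero hp hp3 (N := 4) (m := m) (by omega) (by omega) (by omega)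
    (by omega)
  have hsplit := classSum_split (p := p) (N := 2) (M := 4) (c := 0) {0, 2} (by
    intro r; simp only [Finset.mem_insert, Finset.mem_singleton]; omega)
  rw [Finset.sum_pair (by norm_num)] at hsplit
  have h20 := classSum_two_zero hp hp3
  rw [hsplit] at h20
  generalize (∑ i ∈ Finset.range (m + 1), i ^ (p - 3)) = S at *
  -- Even residues contribute zero modulo p, so the classes 0 and 2 modulo 4 have opposite sums,
  -- while 16 times the sum of class 0 is S.
  have hS : (p : ZMod (p ^ 3)) ^ 2 * ((16 * classSum p 4 2 + S : ℤ) : ZMod (p ^ 3)) = 0 := by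
    apply sq_mul_intCast_eq_zero
    push_cast at hs0 h20 ⊢
    linear_combination 16 * h20 - hs0
  have hpow := pow_eq_prod_classProd hp (N := 4) (by omega) hp4
  simp only [Finset.prod_range_succ, Finset.prod_range_zero] at hpow
  norm_num at hpow
  rw [classProd_zero, one_mul] at hpow
  have r1 := classProd_reflect (p := p) (N := 4) (c := 0) (c' := 1) hp 3 (by intro r h0 hr; omega)
  have r3 := classProd_reflect (p := p) (N := 4) (c := 2) (c' := 3) hp 1 (by intro r h0 hr; omega)
  have hprod := classProd_split (p := p) (N := 2) (M := 4) (c := 0) {0, 2} (-1) (by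
    intro r; simp only [Finset.mem_insert, Finset.mem_singleton]; omega)
  rw [Finset.prod_pair (by norm_num), classProd_two_zero_neg_one hp hp3] at hprod
  have m2 := classProd_mul hp hp3 4 2 2 (-2)
  norm_num at r1 r3 m2 hf hS
  rw [classProd_zero, one_mul] at m2
  have h8 : (8 : ZMod (p ^ 3)) ^ (p - 1) = 4 ^ (p - 1) * 2 ^ (p - 1) := by
    rw [← mul_pow]; norm_num
  rw [mul_assoc, ← hf]
  -- 8^(p-1) = 4^(p-1) · 2^(p-1). Reflection turns the odd classes of 4^(p-1) into even ones, the
  -- class products of 2^(p-1) absorb the denominators, and F_{4,2}(2) F_{4,2}(-2) leaves the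
  -- correction.
  have key : (8 : ZMod (p ^ 3)) ^ (p - 1) =
      (1 + -(2 * 2 * (p : ZMod (p ^ 3)) ^ 2 * classSum p 4 2)) * classProd p 4 0 (-4) := by
    rw [h8, hprod, hpow]
    linear_combination (classProd p 4 0 (-1) * classProd p 4 1 3 * classProd p 4 2 2) * r3 +
      classProd p 4 2 2 * classProd p 4 2 (-2) * r1 + classProd p 4 0 (-4) * m2
  rw [key]
  generalize classProd p 4 0 (-4) = f at *
  generalize (classSum p 4 2 : ZMod (p ^ 3)) = s at *
  linear_combination f * hS - 4 * p * s * S * f * hc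

end Quarter

/-! ### The binomials C(p-1, (p-1)/3) and C(p-1, (p-1)/6) modulo p^3 -/

section Sixth

variable {p : ℕ}

theorem two_mul_classSum_six (hp3 : 3 < p) {c : ℕ} (hc : c < 3) :
    classSum p 6 (2 * c) = 2 ^ (p - 3) *
      ∑ r ∈ (Finset.Ico 1 p).filter (fun r => r % 3 = c ∧ 2 * r < p), r ^ (p - 3) := by
  unfold classSum
  rw [Finset.mul_sum]
  symm
  refine Finset.sum_nbij' (fun r => 2 * r) (fun r => r / 2) ?_ ?_ ?_ ?_ ?_
  · intro r hr
    simp only [Finset.mem_filter, Finset.mem_Ico] at hr ⊢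
    omega
  · intro r hr
    simp only [Finset.mem_filter, Finset.mem_Ico] at hr ⊢
    omega
  · intro r hr
    simp only [Finset.mem_filter, Finset.mem_Ico] at hr
    omega
  · intro r hr
    simp only [Finset.mem_filter, Finset.mem_Ico] at hr
    omega
  · intro r _
    rw [mul_pow]

/-- Multiples of 3 above p/2 reflect to residues ≡ 1 mod 3 below p/2. Doubling sends residues below
p/2 in the classes 0 and 1 modulo 3 to the classes 0 and 2 modulo 6, at the cost of 2^(p-3) ≡ 1/4.
-/
theorem classSum_three_zero_eq (hp : p.Prime) (hp6 : p % 6 = 1) :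
    (classSum p 3 0 : ZMod p) = 4 * (classSum p 6 0 + classSum p 6 2) := by
  have hp3 : 3 < p := by have := hp.two_le; omega
  have h0 := two_mul_classSum_six (p := p) hp3 (c := 0) (by omega)
  have h1 := two_mul_classSum_six (p := p) hp3 (c := 1) (by omega)
  have h2 := sq_mul_pow_sub_three hp hp3 (N := 2) (by omega) (by omega)
  rw [mul_zero] at h0
  rw [mul_one] at h1
  rw [h0, h1]
  have hev : Even (p - 3) := ⟨(p - 3) / 2, by omega⟩
  have hsplit : classSum p 3 0 =
      ∑ r ∈ (Finset.Ico 1 p).filter (fun r => r % 3 = 0 ∧ 2 * r < p), r ^ (p - 3) +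
      ∑ r ∈ (Finset.Ico 1 p).filter (fun r => r % 3 = 0 ∧ ¬ 2 * r < p), r ^ (p - 3) := by
    rw [classSum, ← Finset.sum_filter_add_sum_filter_not _ (fun r => 2 * r < p),
      Finset.filter_filter, Finset.filter_filter]
  have hrefl : ∑ r ∈ (Finset.Ico 1 p).filter (fun r => r % 3 = 0 ∧ ¬ 2 * r < p),
        (r : ZMod p) ^ (p - 3) =
      ∑ r ∈ (Finset.Ico 1 p).filter (fun r => r % 3 = 1 ∧ 2 * r < p), (r : ZMod p) ^ (p - 3) := by
    refine Finset.sum_nbij' (fun r => p - r) (fun r => p - r) ?_ ?_ ?_ ?_ ?_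
    · intro r hr
      simp only [Finset.mem_filter, Finset.mem_Ico] at hr ⊢
      omega
    · intro r hr
      simp only [Finset.mem_filter, Finset.mem_Ico] at hr ⊢
      omega
    · intro r hr
      simp only [Finset.mem_filter, Finset.mem_Ico] at hr
      omega
    · intro r hr
      simp only [Finset.mem_filter, Finset.mem_Ico] at hr
      omega
    · intro r hr
      simp only [Finset.mem_filter, Finset.mem_Ico] at hr
      rw [Nat.cast_sub (by omega), ZMod.natCast_self, zero_sub, hev.neg_pow]
  rw [hsplit]
  push_cast at h2 ⊢
  rw [hrefl]
  linear_combination (-(∑ r ∈ (Finset.Ico 1 p).filter (fun r => r % 3 = 0 ∧ 2 * r < p),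
        (r : ZMod p) ^ (p - 3)) -
      ∑ r ∈ (Finset.Ico 1 p).filter (fun r => r % 3 = 1 ∧ 2 * r < p), (r : ZMod p) ^ (p - 3)) * h2

/-- Together with the doubling relation, the first two relations leave all these sums proportional
to one of them. The factor 36 is kept because 36 times the sum of class 0 modulo 6 is S, whence S ≡
45 times the sum over multiples of 3. -/
theorem classSum_six_relations (hp : p.Prime) (hp6 : p % 6 = 1) :
    (classSum p 6 0 : ZMod p) + classSum p 6 2 + classSum p 6 4 = 0 ∧
    (classSum p 3 0 : ZMod p) = classSum p 6 0 + classSum p 6 4 ∧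
    (45 : ZMod p) * classSum p 3 0 = 36 * classSum p 6 0 := by
  have hp3 : 3 < p := by have := hp.two_le; omega
  have h1 := classSum_split (p := p) (N := 2) (M := 6) (c := 0) {0, 2, 4} (by
    intro r; simp only [Finset.mem_insert, Finset.mem_singleton]; omega)
  have h2 := classSum_split (p := p) (N := 3) (M := 6) (c := 0) {0, 3} (by
    intro r; simp only [Finset.mem_insert, Finset.mem_singleton]; omega)
  have h3 := classSum_reflect (p := p) (N := 6) (c := 4) (c' := 3) hp hp3 (by intro r h0 hr; omega)
  have h4 := classSum_three_zero_eq hp hp6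
  have h5 := classSum_two_zero hp hp3
  rw [Finset.sum_insert (by decide), Finset.sum_pair (by decide)] at h1
  rw [Finset.sum_pair (by decide)] at h2
  rw [h1] at h5
  rw [h2] at h4 ⊢
  push_cast at h4 h5 ⊢
  refine ⟨by linear_combination h5, by linear_combination h3, ?_⟩
  linear_combination 36 * h5 + 9 * h4 + 36 * h3

theorem classSum_three_two (hp : p.Prime) (hp6 : p % 6 = 1) :
    2 * (classSum p 3 0 : ZMod p) + classSum p 3 2 = 0 := by
  have hp3 : 3 < p := by have := hp.two_le; omega
  have h1 := classSum_split (p := p) (N := 1) (M := 3) (c := 0) {0, 1, 2} (by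
    intro r; simp only [Finset.mem_insert, Finset.mem_singleton]; omega)
  have h3 := classSum_reflect (p := p) (N := 3) (c := 0) (c' := 1) hp hp3 (by intro r h0 hr; omega)
  have h5 := classSum_one_zero hp hp3
  rw [Finset.sum_insert (by decide), Finset.sum_pair (by decide)] at h1
  rw [h1] at h5
  push_cast at h5
  linear_combination h5 - h3

/-- 3^(p-1) = F_1(2) F_2(1). Reflection converts F_1(2) into F_0(-3)/F_0(-1) and fixes class 2,
which makes F_2(1) a pure p^2 correction. Comparing F_0(-3) with F_0(-1)^3 leaves the square. -/
theorem classProd_three_zero_sq (hp : p.Prime) (hp6 : p % 6 = 1) :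
    classProd p 3 0 (-1) ^ 2 =
      3 ^ (p - 1) * (1 + (p : ZMod (p ^ 3)) ^ 2 * classSum p 3 0) := by
  have hp3 : 3 < p := by have := hp.two_le; omega
  have hpow := pow_eq_prod_classProd hp (N := 3) (by omega) (by omega)
  simp only [Finset.prod_range_succ, Finset.prod_range_zero] at hpow
  norm_num at hpow
  rw [classProd_zero, one_mul] at hpow
  have r1 := classProd_reflect (p := p) (N := 3) (c := 0) (c' := 1) hp 2 (by intro r h0 hr; omega)
  have r2 := classProd_reflect (p := p) (N := 3) (c := 2) (c' := 2) hp (-1)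
    (by intro r h0 hr; omega)
  have m0 := classProd_mul hp hp3 3 0 (-1) (-1)
  have m1 := classProd_mul hp hp3 3 0 (-2) (-1)
  have m2 := classProd_mul hp hp3 3 2 1 (-1)
  have hs := sq_mul_intCast_eq_zero (p := p) (z := 2 * classSum p 3 0 + classSum p 3 2)
    (by push_cast; exact classSum_three_two hp hp6)
  norm_num at r1 r2 m0 m1 m2 hs
  rw [classProd_zero] at r2 m2
  -- Class 2 is its own reflection when p ≡ 1 mod 3, so this product squares to 1.
  have hone : classProd p 3 2 (-1) = 1 := by
    obtain ⟨y, hy⟩ := exists_classProd_eq (p := p) 3 2 (-1)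
    exact eq_of_sq_eq_sq_of_eq_one_add hp hp3 hy (b := 0) (by ring) (by rw [sq, r2, one_pow])
  rw [hone] at m2
  have hq : (p : ZMod (p ^ 3)) ^ 2 * (p : ZMod (p ^ 3)) ^ 2 = 0 := by
    linear_combination (p : ZMod (p ^ 3)) * cast_prime_cube p
  refine (isUnit_classProd 3 0 (-1)).mul_left_cancel ?_
  generalize (p : ZMod (p ^ 3)) ^ 2 = q at *
  rw [hpow]
  generalize classProd p 3 0 (-1) = f1 at *
  generalize classProd p 3 0 (-2) = f2 at *
  generalize classProd p 3 0 (-3) = f3 at *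
  generalize classProd p 3 1 2 = g at *
  generalize classProd p 3 2 1 = h at *
  generalize (classSum p 3 0 : ZMod (p ^ 3)) = s at *
  generalize (classSum p 3 2 : ZMod (p ^ 3)) = t at *
  linear_combination f1 * m0 + (1 + q * s) * m1 - h * (1 + q * s) * r1 -
    f3 * (1 + q * s) * m2 + f3 * (1 + q * s) * hs

theorem exists_mul_eq_one_add {x y : ZMod (p ^ 3)}
    (hx : ∃ a, x = 1 + (p : ZMod (p ^ 3)) * a) (hy : ∃ a, y = 1 + (p : ZMod (p ^ 3)) * a) :
    ∃ a, x * y = 1 + (p : ZMod (p ^ 3)) * a := by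
  obtain ⟨a, rfl⟩ := hx
  obtain ⟨b, rfl⟩ := hy
  exact ⟨a + b + (p : ZMod (p ^ 3)) * a * b, by ring⟩

theorem legendreSym_three_two : @legendreSym 3 ⟨Nat.prime_three⟩ 2 = -1 := by
  decide

/-- Euler's criterion, with (-3/p) = (p/3): the sign (-1)^((p-1)/2) of (-1/p) cancels the one from
quadratic reciprocity. -/
theorem neg_three_pow_half (hp : p.Prime) (hp3 : 3 < p) :
    (-3 : ZMod p) ^ ((p - 1) / 2) = if p % 3 = 1 then 1 else -1 := by
  have := Fact.mk hp
  have : Fact (Nat.Prime 3) := ⟨Nat.prime_three⟩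
  have hodd := hp.odd_of_ne_two (by omega)
  rw [Nat.odd_iff] at hodd
  have h3 : p % 3 ≠ 0 := by
    intro h
    have := (Nat.prime_dvd_prime_iff_eq Nat.prime_three hp).1 (Nat.dvd_of_mod_eq_zero h)
    omega
  have hdiv : (p - 1) / 2 = p / 2 := by omega
  have h1 := legendreSym.eq_pow p (-3)
  have h2 : legendreSym p (-3) = legendreSym 3 p := by
    rw [show (-3 : ℤ) = (-1) * ((3 : ℕ) : ℤ) by norm_num, legendreSym.mul,
      legendreSym.at_neg_one (by omega),
      legendreSym.quadratic_reciprocity' (p := 3) (q := p) (by omega) (by omega),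
      ZMod.χ₄_eq_neg_one_pow hodd, ← mul_assoc, ← pow_add]
    norm_num
  rw [h2, legendreSym.mod] at h1
  push_cast at h1
  rw [hdiv, ← h1]
  split_ifs with h
  · have : (p : ℤ) % 3 = 1 := by omega
    rw [this]
    simp
  · have : (p : ℤ) % 3 = 2 := by omega
    rw [this]
    rw [legendreSym_three_two]
    simp

/-- This fixes the sign in the square roots below: (p-1)/2 is three times (p-1)/6, so the left side
is (-3)^((p-1)/2). -/
theorem exists_neg_one_pow_mul_three_pow (hp : p.Prime) (hp6 : p % 6 = 1) :
    ∃ a, (-1) ^ ((p - 1) / 6) * (3 : ZMod (p ^ 3)) ^ ((p - 1) / 2) =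
      1 + (p : ZMod (p ^ 3)) * a := by
  have hp3 : 3 < p := by have := hp.two_le; omega
  have h := neg_three_pow_half hp hp3
  rw [if_pos (by omega)] at h
  have hz : (((-3) ^ ((p - 1) / 2) - 1 : ℤ) : ZMod p) = 0 := by
    push_cast
    rw [h, sub_self]
  obtain ⟨k, hk⟩ := (ZMod.intCast_zmod_eq_zero_iff_dvd _ p).1 hz
  refine ⟨(k : ZMod (p ^ 3)), ?_⟩
  have hk2 := congrArg (fun z : ℤ => (z : ZMod (p ^ 3))) hk
  push_cast at hk2
  have hn : (-1 : ZMod (p ^ 3)) ^ ((p - 1) / 6) = (-1) ^ ((p - 1) / 2) := by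
    rw [show (p - 1) / 2 = 3 * ((p - 1) / 6) by omega, pow_mul]
    norm_num
  rw [hn, ← mul_pow, neg_one_mul]
  linear_combination hk2

theorem choose_third (hp : p.Prime) (hp6 : p % 6 = 1) :
    30 * ((p - 1).choose ((p - 1) / 3) : ZMod (p ^ 3)) =
      (-1) ^ ((p - 1) / 6) * 27 ^ ((p - 1) / 2) * (30 - (p : ZMod (p ^ 3)) ^ 2 *
        ((∑ i ∈ Finset.range ((p - 1) / 6 + 1), i ^ (p - 3) : ℕ) : ZMod (p ^ 3))) := by
  have hp3 : 3 < p := by have := hp.two_le; omega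
  have hf := prod_one_sub_div_eq_choose hp (show (p - 1) / 3 < p by omega)
  rw [← classProd_zero_mul hp (N := 3) (by omega) (by omega) (by omega)] at hf
  have hs0 := sq_mul_classSum_zero hp hp3 (N := 6) (m := (p - 1) / 6) (by omega) (by omega)
    (by omega) (by omega)
  obtain ⟨-, -, hr⟩ := classSum_six_relations hp hp6
  generalize (∑ i ∈ Finset.range ((p - 1) / 6 + 1), i ^ (p - 3)) = S at *
  have hS : (p : ZMod (p ^ 3)) ^ 2 * ((45 * classSum p 3 0 - S : ℤ) : ZMod (p ^ 3)) = 0 := by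
    apply sq_mul_intCast_eq_zero
    push_cast at hs0 ⊢
    linear_combination hr + hs0
  have hsq := classProd_three_zero_sq hp hp6
  have hu := natCast_mul_inv_of_lt hp (show 0 < 2 by omega) (by omega)
  have hq : (p : ZMod (p ^ 3)) ^ 2 * (p : ZMod (p ^ 3)) ^ 2 = 0 := by
    linear_combination (p : ZMod (p ^ 3)) * cast_prime_cube p
  have he := exists_neg_one_pow_mul_three_pow hp hp6
  have h27 : (27 : ZMod (p ^ 3)) ^ ((p - 1) / 2) = (3 ^ ((p - 1) / 2)) ^ 3 := by
    rw [← pow_mul, mul_comm, pow_mul]; norm_num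
  have h3 : (3 : ZMod (p ^ 3)) ^ (p - 1) = (3 ^ ((p - 1) / 2)) ^ 2 := by
    rw [← pow_mul]; congr 1; omega
  have hpar : (-1 : ZMod (p ^ 3)) ^ ((p - 1) / 3) = 1 :=
    Even.neg_one_pow ⟨(p - 1) / 6, by omega⟩
  have hsgn : ((-1 : ZMod (p ^ 3)) ^ ((p - 1) / 6)) ^ 2 = 1 := by
    rw [← pow_mul, mul_comm, pow_mul]; norm_num
  rw [h27]
  rw [h3] at hsq
  rw [hpar, one_mul] at hf
  generalize (3 : ZMod (p ^ 3)) ^ ((p - 1) / 2) = t at *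
  generalize (-1 : ZMod (p ^ 3)) ^ ((p - 1) / 6) = e at *
  -- The square root of 3^(p-1)(1 + p^2 s) that is 1 modulo p. Cubing it gives F_0(-3) up to a p^2
  -- correction, which is the binomial sought.
  have hroot : classProd p 3 0 (-1) = e * t *
      (1 + (p : ZMod (p ^ 3)) ^ 2 * (classSum p 3 0 : ZMod (p ^ 3)) * ((2 : ℕ) : ZMod (p ^ 3))⁻¹) := by
    obtain ⟨a, ha⟩ := exists_classProd_eq (p := p) 3 0 (-1)
    obtain ⟨b, hb⟩ := exists_mul_eq_one_add he (y := 1 + (p : ZMod (p ^ 3)) ^ 2 *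
      (classSum p 3 0 : ZMod (p ^ 3)) * ((2 : ℕ) : ZMod (p ^ 3))⁻¹)
      ⟨(p : ZMod (p ^ 3)) * (classSum p 3 0 : ZMod (p ^ 3)) * ((2 : ℕ) : ZMod (p ^ 3))⁻¹, by ring⟩
    refine eq_of_sq_eq_sq_of_eq_one_add hp hp3 ha hb ?_
    rw [hsq]
    generalize ((2 : ℕ) : ZMod (p ^ 3))⁻¹ = h at *
    generalize (p : ZMod (p ^ 3)) ^ 2 = q at *
    generalize (classSum p 3 0 : ZMod (p ^ 3)) = s at *
    push_cast at hu
    linear_combination (-t ^ 2 * (1 + q * s * h) ^ 2) * hsgn - t ^ 2 * q * s * hu -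
      t ^ 2 * s ^ 2 * h ^ 2 * hq
  have m0 := classProd_mul hp hp3 3 0 (-1) (-1)
  have m1 := classProd_mul hp hp3 3 0 (-2) (-1)
  norm_num at m0 m1 hf hS hu
  rw [← hf]
  generalize (2 : ZMod (p ^ 3))⁻¹ = h at *
  generalize (p : ZMod (p ^ 3)) ^ 2 = q at *
  generalize classProd p 3 0 (-1) = f1 at *
  generalize classProd p 3 0 (-2) = f2 at *
  generalize classProd p 3 0 (-3) = f3 at *
  generalize (classSum p 3 0 : ZMod (p ^ 3)) = s at *
  have k1 : f1 ^ 3 = f3 * (1 + 3 * q * s) := by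
    linear_combination f1 * m0 + (1 + q * s) * m1 + f3 * 2 * s ^ 2 * hq
  rw [hroot] at k1
  linear_combination (-30 * (1 - 3 * q * s)) * k1 + 270 * f3 * s ^ 2 * hq +
    30 * (1 - 3 * q * s) * (1 + q * s * h) ^ 3 * e * t ^ 3 * hsgn +
    e * t ^ 3 * (45 * q * s * hu - hS +
      30 * ((3 * h ^ 2 * s ^ 2 - 9 * s ^ 2 * h) + q * (s ^ 3 * h ^ 3 - 9 * s ^ 3 * h ^ 2) -
        3 * q ^ 2 * s ^ 4 * h ^ 3) * hq)

/-- 432 = 6 · 2 · 4 · 3^2: the relation for 6^(p-1), the three even classes at level 2 (used at -1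
and at 2) and the square at level 3 suffice to eliminate every class except 0. -/
theorem classProd_six_zero_sq (hp : p.Prime) (hp6 : p % 6 = 1) :
    classProd p 6 0 (-6) ^ 2 =
      432 ^ (p - 1) * (1 - 24 * (p : ZMod (p ^ 3)) ^ 2 * classSum p 6 0) := by
  have hp3 : 3 < p := by have := hp.two_le; omega
  have hq : (p : ZMod (p ^ 3)) ^ 2 * (p : ZMod (p ^ 3)) ^ 2 = 0 := by
    linear_combination (p : ZMod (p ^ 3)) * cast_prime_cube p
  obtain ⟨hr1, hr2, -⟩ := classSum_six_relations hp hp6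
  have hs := sq_mul_intCast_eq_zero (p := p) (z := classSum p 6 0 + classSum p 6 2 + classSum p 6 4)
    (by push_cast; exact hr1)
  have hs' := sq_mul_intCast_eq_zero (p := p) (z := classSum p 3 0 - classSum p 6 0 - classSum p 6 4)
    (by push_cast; linear_combination hr2)
  have hpow := pow_eq_prod_classProd hp (N := 6) (by omega) (by omega)
  simp only [Finset.prod_range_succ, Finset.prod_range_zero] at hpow
  norm_num at hpow
  rw [classProd_zero, one_mul] at hpow
  have r1 := classProd_reflect (p := p) (N := 6) (c := 0) (c' := 1) hp 5 (by intro r h0 hr; omega)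
  have r3 := classProd_reflect (p := p) (N := 6) (c := 4) (c' := 3) hp 3 (by intro r h0 hr; omega)
  have r5 := classProd_reflect (p := p) (N := 6) (c := 2) (c' := 5) hp 1 (by intro r h0 hr; omega)
  have r3' := classProd_reflect (p := p) (N := 6) (c := 4) (c' := 3) hp (-1)
    (by intro r h0 hr; omega)
  have e1 := classProd_split (p := p) (N := 2) (M := 6) (c := 0) {0, 2, 4} (-1) (by
    intro r; simp only [Finset.mem_insert, Finset.mem_singleton]; omega)
  have e2 := classProd_split (p := p) (N := 2) (M := 6) (c := 0) {0, 2, 4} 2 (by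
    intro r; simp only [Finset.mem_insert, Finset.mem_singleton]; omega)
  have k1 := classProd_split (p := p) (N := 3) (M := 6) (c := 0) {0, 3} (-1) (by
    intro r; simp only [Finset.mem_insert, Finset.mem_singleton]; omega)
  rw [Finset.prod_insert (by decide), Finset.prod_pair (by decide)] at e1 e2
  rw [Finset.prod_pair (by decide)] at k1
  rw [classProd_two_zero_neg_one hp hp3] at e1
  have e3 := classProd_two_zero_two hp hp3
  rw [e2] at e3
  have k2 := classProd_three_zero_sq hp hp6
  rw [k1] at k2
  have m1 := classProd_mul hp hp3 6 2 4 (-2)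
  have m2 := classProd_mul hp hp3 6 4 (-4) 2
  have m3 := classProd_mul hp hp3 6 4 (-2) 2
  have m4 := classProd_mul hp hp3 6 4 (-1) (-1)
  have m5 := classProd_mul hp hp3 6 0 (-1) (-1)
  have m6 := classProd_mul hp hp3 6 0 (-2) (-2)
  have m7 := classProd_mul hp hp3 6 0 2 (-2)
  have m8 := classProd_mul hp hp3 6 0 (-4) (-2)
  norm_num at r1 r3 r5 r3' m1 m2 m3 m4 m5 m6 m7 m8 hs hs'
  rw [classProd_zero] at r3' m3 m7
  have h432 : (432 : ZMod (p ^ 3)) ^ (p - 1) =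
      6 ^ (p - 1) * 2 ^ (p - 1) * 4 ^ (p - 1) * (3 ^ (p - 1)) ^ 2 := by
    rw [sq, ← mul_pow, ← mul_pow, ← mul_pow, ← mul_pow]; norm_num
  rw [h432]
  generalize (p : ZMod (p ^ 3)) ^ 2 = q at *
  generalize (6 : ZMod (p ^ 3)) ^ (p - 1) = P6 at *
  generalize (2 : ZMod (p ^ 3)) ^ (p - 1) = P2 at *
  generalize (3 : ZMod (p ^ 3)) ^ (p - 1) = P3 at *
  generalize (4 : ZMod (p ^ 3)) ^ (p - 1) = P4 at *
  generalize (classSum p 6 0 : ZMod (p ^ 3)) = s0 at *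
  generalize (classSum p 6 2 : ZMod (p ^ 3)) = s2 at *
  generalize (classSum p 6 4 : ZMod (p ^ 3)) = s4 at *
  generalize (classSum p 3 0 : ZMod (p ^ 3)) = σ at *
  -- Reflection moves the odd classes of 6^(p-1) to even ones; the factors F(-1) this creates in the
  -- denominator are exactly those of 2^(p-1).
  have i1 : P6 * P2 = classProd p 6 0 (-6) * (classProd p 6 2 2 * (1 - 8 * q * s2)) *
      (classProd p 6 4 (-2) * (1 - 8 * q * s4)) := by
    rw [show classProd p 6 2 2 * (1 - 8 * q * s2) = classProd p 6 2 4 * classProd p 6 2 (-2) by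
        linear_combination -m1,
      show classProd p 6 4 (-2) * (1 - 8 * q * s4) = classProd p 6 4 (-4) * classProd p 6 4 2 by
        linear_combination -m2, ← r1, ← r3, ← r5, e1, hpow]
    ring
  -- Multiples of 3 are the classes 0 and 3 modulo 6, and F_3(-1) is inverse to F_4(-1) by
  -- reflection.
  have i2 : classProd p 6 0 (-1) ^ 2 = P3 * (1 + q * σ) * classProd p 6 4 (-1) ^ 2 := by
    rw [← k2]
    linear_combination (-classProd p 6 0 (-1) ^ 2 *
      (classProd p 6 3 (-1) * classProd p 6 4 (-1) + 1)) * r3'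
  generalize classProd p 6 0 (-6) = a6 at *
  generalize classProd p 6 0 (-4) = a4 at *
  generalize classProd p 6 0 (-2) = a2 at *
  generalize classProd p 6 0 (-1) = a1 at *
  generalize classProd p 6 0 2 = b2 at *
  generalize classProd p 6 2 2 = d2 at *
  generalize classProd p 6 4 2 = c2 at *
  generalize classProd p 6 4 (-2) = c2' at *
  generalize classProd p 6 4 (-1) = c1 at *
  clear r1 r3 r5 hpow m1 m2 k1 k2 e1 e2 h432
  -- Class 2 disappears because 4^(p-1) F_0(2) F_2(2) F_4(2) = 1.
  have i3 : P6 * P2 * P4 * b2 * c2 ^ 2 =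
      a6 * (1 - 4 * q * s4) * (1 - 8 * q * s2) * (1 - 8 * q * s4) := by
    linear_combination b2 * c2 ^ 2 * P4 * i1 +
      a6 * c2' * c2 * (1 - 8 * q * s2) * (1 - 8 * q * s4) * e3 +
      a6 * (1 - 8 * q * s2) * (1 - 8 * q * s4) * m3
  -- Class 4 is now expressed through F_4(-1) alone, which `i6` trades for class 0 by means of `i2`.
  have i4 : c2 * c1 ^ 2 = 1 - 3 * q * s4 := by
    linear_combination c2 * m4 + (1 + q * s4) * m3 - 4 * s4 ^ 2 * hq
  have i5 : P6 * P2 * P4 * b2 * (1 - 6 * q * s4) =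
      a6 * c1 ^ 4 * (1 - 12 * q * s4 - 8 * q * s2) := by
    linear_combination c1 ^ 4 * i3 - P6 * P2 * P4 * b2 * (c2 * c1 ^ 2 + 1 - 3 * q * s4) * i4 -
      P6 * P2 * P4 * b2 * 9 * s4 ^ 2 * hq +
      a6 * c1 ^ 4 * (32 * s4 ^ 2 + 96 * s4 * s2 - 256 * q * s4 ^ 2 * s2) * hq
  have i6 : a2 ^ 2 * (1 + 2 * q * s0) = P3 ^ 2 * (1 + 2 * q * σ) * c1 ^ 4 := by
    linear_combination (a1 ^ 2 + P3 * (1 + q * σ) * c1 ^ 2) * i2 -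
      (a1 ^ 2 + a2 * (1 + q * s0)) * m5 + (P3 ^ 2 * c1 ^ 4 * σ ^ 2 - a2 ^ 2 * s0 ^ 2) * hq
  have i7 : a2 ^ 3 = a6 * (1 + 12 * q * s0) := by
    linear_combination a2 * m6 + (1 + 4 * q * s0) * m8 + a6 * 32 * s0 ^ 2 * hq
  have i8 : P6 * P2 * P4 * P3 ^ 2 *
        ((1 - 4 * (q * s0)) * (1 - 6 * (q * s4)) * (1 + 2 * (q * σ))) =
      a6 ^ 2 * ((1 + 12 * (q * s0)) * (1 + 2 * (q * s0)) *
        (1 - 12 * (q * s4) - 8 * (q * s2))) := by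
    linear_combination a2 * P3 ^ 2 * (1 + 2 * q * σ) * i5 -
      a2 * a6 * (1 - 12 * q * s4 - 8 * q * s2) * i6 +
      a6 * (1 + 2 * q * s0) * (1 - 12 * q * s4 - 8 * q * s2) * i7 -
      P6 * P2 * P4 * P3 ^ 2 * (1 - 6 * q * s4) * (1 + 2 * q * σ) * m7
  have hx : q * s0 * (q * s0) = 0 := by linear_combination s0 ^ 2 * hq
  have hxy : q * s0 * (q * s4) = 0 := by linear_combination s0 * s4 * hq
  have hy : q * s4 * (q * s4) = 0 := by linear_combination s4 ^ 2 * hq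
  rw [show q * σ = q * s0 + q * s4 by linear_combination hs',
    show q * s2 = -(q * s0) - q * s4 by linear_combination hs] at i8
  rw [mul_assoc 24 q s0]
  generalize q * s0 = x at *
  generalize q * s4 = y at *
  -- All products of two corrections vanish since p^4 = 0, so both sides are expanded to first order
  -- in x and y. The quotient (1 - 2x - 4y)/(1 + 22x - 4y) is then 1 - 24x.
  have i9 : P6 * P2 * P4 * P3 ^ 2 * (1 - 2 * x - 4 * y) = a6 ^ 2 * (1 + 22 * x - 4 * y) := by
    linear_combination i8 - P6 * P2 * P4 * P3 ^ 2 *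
        (4 * hxy - 8 * hx - 12 * hy + 48 * (x + y) * hxy) +
      a6 ^ 2 * (136 * hx - 56 * hxy + 192 * x * hx - 96 * x * hxy)
  linear_combination (-(1 - 22 * x + 4 * y)) * i9 +
    a6 ^ 2 * (484 * hx - 176 * hxy + 16 * hy) +
    P6 * P2 * P4 * P3 ^ 2 * (44 * hx + 80 * hxy - 16 * hy)

theorem choose_sixth (hp : p.Prime) (hp6 : p % 6 = 1) :
    3 * ((p - 1).choose ((p - 1) / 6) : ZMod (p ^ 3)) =
      27 ^ ((p - 1) / 2) * 4 ^ (p - 1) * (3 - (p : ZMod (p ^ 3)) ^ 2 *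
        ((∑ i ∈ Finset.range ((p - 1) / 6 + 1), i ^ (p - 3) : ℕ) : ZMod (p ^ 3))) := by
  have hp3 : 3 < p := by have := hp.two_le; omega
  have hf := prod_one_sub_div_eq_choose hp (show (p - 1) / 6 < p by omega)
  rw [← classProd_zero_mul hp (N := 6) (by omega) (by omega) (by omega)] at hf
  have hs0 := sq_mul_classSum_zero hp hp3 (N := 6) (m := (p - 1) / 6) (by omega) (by omega)
    (by omega) (by omega)
  generalize (∑ i ∈ Finset.range ((p - 1) / 6 + 1), i ^ (p - 3)) = S at *
  have hS : (p : ZMod (p ^ 3)) ^ 2 * ((36 * classSum p 6 0 - S : ℤ) : ZMod (p ^ 3)) = 0 := by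
    apply sq_mul_intCast_eq_zero
    push_cast at hs0 ⊢
    linear_combination hs0
  have hsq := classProd_six_zero_sq hp hp6
  have hq : (p : ZMod (p ^ 3)) ^ 2 * (p : ZMod (p ^ 3)) ^ 2 = 0 := by
    linear_combination (p : ZMod (p ^ 3)) * cast_prime_cube p
  have he := exists_neg_one_pow_mul_three_pow hp hp6
  have h4 : ∃ a, (2 : ZMod (p ^ 3)) ^ (p - 1) = 1 + (p : ZMod (p ^ 3)) * a := by
    rw [← classProd_two_zero_neg_one hp hp3]
    exact exists_classProd_eq _ _ _
  have h27 : (27 : ZMod (p ^ 3)) ^ ((p - 1) / 2) = (3 ^ ((p - 1) / 2)) ^ 3 := by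
    rw [← pow_mul, mul_comm, pow_mul]; norm_num
  have h432 : (432 : ZMod (p ^ 3)) ^ (p - 1) = (2 ^ (p - 1)) ^ 4 * (3 ^ ((p - 1) / 2)) ^ 6 := by
    rw [← pow_mul (3 : ZMod (p ^ 3)), show (p - 1) / 2 * 6 = 3 * (p - 1) by omega, pow_mul,
      ← pow_mul, mul_comm (p - 1), pow_mul, ← mul_pow]
    norm_num
  have h44 : (4 : ZMod (p ^ 3)) ^ (p - 1) = (2 ^ (p - 1)) ^ 2 := by
    rw [← pow_mul, mul_comm, pow_mul]; norm_num
  have hsgn : ((-1 : ZMod (p ^ 3)) ^ ((p - 1) / 6)) ^ 2 = 1 := by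
    rw [← pow_mul, mul_comm, pow_mul]; norm_num
  rw [h27, h44]
  rw [h432] at hsq
  generalize (3 : ZMod (p ^ 3)) ^ ((p - 1) / 2) = t at *
  generalize (2 : ZMod (p ^ 3)) ^ (p - 1) = w at *
  generalize (-1 : ZMod (p ^ 3)) ^ ((p - 1) / 6) = e at *
  -- 432^(p-1) = 2^(4(p-1)) · 3^(3(p-1)); its root congruent to 1 modulo p is 4^(p-1) times the cube
  -- of the normalised 3^((p-1)/2), and 24 is halved to 12.
  have hroot : classProd p 6 0 (-6) = (w * w) * ((e * t) * ((e * t) * (e * t))) *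
      (1 + (p : ZMod (p ^ 3)) * (-12 * (p : ZMod (p ^ 3)) * (classSum p 6 0 : ZMod (p ^ 3)))) := by
    obtain ⟨a, ha⟩ := exists_classProd_eq (p := p) 6 0 (-6)
    obtain ⟨b, hb⟩ := exists_mul_eq_one_add (exists_mul_eq_one_add (exists_mul_eq_one_add h4 h4)
      (exists_mul_eq_one_add he (exists_mul_eq_one_add he he)))
      (y := 1 + (p : ZMod (p ^ 3)) * (-12 * (p : ZMod (p ^ 3)) * (classSum p 6 0 : ZMod (p ^ 3)))) ⟨_, rfl⟩
    refine eq_of_sq_eq_sq_of_eq_one_add hp hp3 ha hb ?_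
    rw [hsq]
    generalize (classSum p 6 0 : ZMod (p ^ 3)) = s at *
    have h6 : e ^ 6 = 1 := by linear_combination (e ^ 4 + e ^ 2 + 1) * hsgn
    generalize (p : ZMod (p ^ 3)) = q at *
    linear_combination (-w ^ 4 * t ^ 6 * (1 - 12 * q ^ 2 * s) ^ 2) * h6 -
      144 * w ^ 4 * t ^ 6 * s ^ 2 * hq
  norm_num at hf hS
  rw [hroot] at hf
  have he4 : e ^ 4 = 1 := by linear_combination (e ^ 2 + 1) * hsgn
  generalize (p : ZMod (p ^ 3)) = q at *
  generalize (classSum p 6 0 : ZMod (p ^ 3)) = s at *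
  linear_combination (-3 * e) * hf - 3 * ((p - 1).choose ((p - 1) / 6) : ZMod (p ^ 3)) * hsgn +
    3 * w ^ 2 * t ^ 3 * (1 - 12 * q ^ 2 * s) * he4 - w ^ 2 * t ^ 3 * hS

end Sixth

/-! ### Calculus of congruences between p-integral rationals -/

section PadicCongr

variable {p : ℕ}

theorem den_not_dvd_iff {x : ℚ} :
    ¬ p ∣ x.den ↔ ∃ (a : ℤ) (b : ℕ), ¬ p ∣ b ∧ x = a / b := by
  constructor
  · intro h
    exact ⟨x.num, x.den, h, (Rat.num_div_den x).symm⟩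
  · rintro ⟨a, b, hb, rfl⟩ h
    have h2 := Rat.den_dvd a b
    rw [Rat.divInt_eq_div, Int.cast_natCast] at h2
    exact hb (h.trans (by exact_mod_cast h2))

/-- The ring of rational numbers whose denominator is prime to `p`. -/
def padicIntegral (p : ℕ) (hp : p.Prime) : Subring ℚ where
  carrier := {x | ¬ p ∣ x.den}
  mul_mem' := by
    intro x y hx hy h
    rcases hp.dvd_mul.1 (h.trans (Rat.mul_den_dvd x y)) with h | h
    · exact hx h
    · exact hy h
  one_mem' := by simpa using hp.one_lt.ne'
  add_mem' := by
    intro x y hx hy h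
    rcases hp.dvd_mul.1 (h.trans (Rat.add_den_dvd x y)) with h | h
    · exact hx h
    · exact hy h
  zero_mem' := by simpa using hp.one_lt.ne'
  neg_mem' := by
    intro x hx
    simpa using hx

theorem inv_natCast_mem (hp : p.Prime) {r : ℕ} (hr : ¬ p ∣ r) :
    (r : ℚ)⁻¹ ∈ padicIntegral p hp :=
  den_not_dvd_iff.2 ⟨1, r, hr, by simp⟩

theorem padicCongr_iff (hp : p.Prime) {k : ℕ} {a b : ℚ} :
    PadicCongr p k a b ↔ ∃ c ∈ padicIntegral p hp, a - b = (p : ℚ) ^ k * c :=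
  Iff.rfl

theorem PadicCongr.refl (hp : p.Prime) (k : ℕ) (a : ℚ) : PadicCongr p k a a :=
  (padicCongr_iff hp).2 ⟨0, Subring.zero_mem _, by ring⟩

theorem PadicCongr.symm (hp : p.Prime) {k : ℕ} {a b : ℚ} (h : PadicCongr p k a b) :
    PadicCongr p k b a := by
  obtain ⟨c, hc, h⟩ := (padicCongr_iff hp).1 h
  exact (padicCongr_iff hp).2 ⟨-c, Subring.neg_mem _ hc, by linear_combination -h⟩

theorem PadicCongr.trans (hp : p.Prime) {k : ℕ} {a b c : ℚ} (h : PadicCongr p k a b)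
    (h' : PadicCongr p k b c) : PadicCongr p k a c := by
  obtain ⟨x, hx, h⟩ := (padicCongr_iff hp).1 h
  obtain ⟨y, hy, h'⟩ := (padicCongr_iff hp).1 h'
  exact (padicCongr_iff hp).2 ⟨x + y, Subring.add_mem _ hx hy, by linear_combination h + h'⟩

theorem PadicCongr.add (hp : p.Prime) {k : ℕ} {a b c d : ℚ} (h : PadicCongr p k a b)
    (h' : PadicCongr p k c d) : PadicCongr p k (a + c) (b + d) := by
  obtain ⟨x, hx, h⟩ := (padicCongr_iff hp).1 h
  obtain ⟨y, hy, h'⟩ := (padicCongr_iff hp).1 h'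
  exact (padicCongr_iff hp).2 ⟨x + y, Subring.add_mem _ hx hy, by linear_combination h + h'⟩

theorem PadicCongr.mul_left (hp : p.Prime) {k : ℕ} {a b c : ℚ} (hc : c ∈ padicIntegral p hp)
    (h : PadicCongr p k a b) : PadicCongr p k (c * a) (c * b) := by
  obtain ⟨x, hx, h⟩ := (padicCongr_iff hp).1 h
  exact (padicCongr_iff hp).2 ⟨c * x, Subring.mul_mem _ hc hx, by linear_combination c * h⟩

theorem PadicCongr.sum (hp : p.Prime) {k : ℕ} {s : Finset ℕ} {f g : ℕ → ℚ}
    (h : ∀ i ∈ s, PadicCongr p k (f i) (g i)) :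
    PadicCongr p k (∑ i ∈ s, f i) (∑ i ∈ s, g i) := by
  induction s using Finset.induction_on with
  | empty => exact PadicCongr.refl hp k _
  | insert a s ha ih =>
    rw [Finset.sum_insert ha, Finset.sum_insert ha]
    exact (h a (Finset.mem_insert_self a s)).add hp
      (ih fun i hi => h i (Finset.mem_insert_of_mem hi))

theorem PadicCongr.pow_mul (hp : p.Prime) {k : ℕ} (l : ℕ) {a b : ℚ} (h : PadicCongr p k a b) :
    PadicCongr p (l + k) ((p : ℚ) ^ l * a) ((p : ℚ) ^ l * b) := by
  obtain ⟨x, hx, h⟩ := (padicCongr_iff hp).1 h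
  exact (padicCongr_iff hp).2 ⟨x, hx, by rw [pow_add]; linear_combination (p : ℚ) ^ l * h⟩

theorem PadicCongr.of_zmod (hp : p.Prime) {k : ℕ} {a b : ℤ}
    (h : (a : ZMod (p ^ k)) = (b : ZMod (p ^ k))) : PadicCongr p k (a : ℚ) (b : ℚ) := by
  have h2 : ((a - b : ℤ) : ZMod (p ^ k)) = 0 := by push_cast; rw [h, sub_self]
  rw [ZMod.intCast_zmod_eq_zero_iff_dvd] at h2
  obtain ⟨c, hc⟩ := h2
  refine (padicCongr_iff hp).2 ⟨c, intCast_mem _ c, ?_⟩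
  exact_mod_cast congrArg (fun z : ℤ => (z : ℚ)) hc

theorem PadicCongr.mem (hp : p.Prime) {k : ℕ} {a b : ℚ} (h : PadicCongr p k a b)
    (hb : b ∈ padicIntegral p hp) : a ∈ padicIntegral p hp := by
  obtain ⟨x, hx, h⟩ := (padicCongr_iff hp).1 h
  rw [show a = b + (p : ℚ) ^ k * x by linear_combination h]
  exact Subring.add_mem _ hb (Subring.mul_mem _ (Subring.pow_mem _ (natCast_mem _ p) k) hx)

theorem PadicCongr.pow (hp : p.Prime) {k : ℕ} {a b : ℚ} (hb : b ∈ padicIntegral p hp)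
    (h : PadicCongr p k a b) (n : ℕ) : PadicCongr p k (a ^ n) (b ^ n) := by
  have ha := h.mem hp hb
  induction n with
  | zero => simpa using PadicCongr.refl hp k 1
  | succ n ih =>
    rw [pow_succ', pow_succ']
    have h1 := ih.mul_left hp ha
    have h2 := h.mul_left hp (Subring.pow_mem _ hb n)
    rw [mul_comm, mul_comm _ b] at h2
    exact h1.trans hp h2

end PadicCongr

/-! ### Power sums, Bernoulli polynomials and Euler numbers modulo p -/

section Bernoulli

variable {p : ℕ}

/-- The recurrence for the Bernoulli numbers divides only by integers n - k + 1 ≤ n + 1 < p. -/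
theorem bernoulli'_mem (hp : p.Prime) {n : ℕ} (hn : n + 1 < p) :
    bernoulli' n ∈ padicIntegral p hp := by
  induction n using Nat.strong_induction_on with
  | _ n ih =>
    rw [bernoulli'_def]
    refine Subring.sub_mem _ (Subring.one_mem _) (Subring.sum_mem _ fun k hk => ?_)
    rw [Finset.mem_range] at hk
    refine Subring.mul_mem _ ?_ (ih k hk (by omega))
    rw [div_eq_mul_inv]
    refine Subring.mul_mem _ (natCast_mem _ _) ?_
    have : ((n : ℚ) - k + 1) = ((n - k + 1 : ℕ) : ℚ) := by
      push_cast [Nat.cast_sub hk.le]; ring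
    rw [this]
    exact inv_natCast_mem hp fun h => absurd (Nat.le_of_dvd (by omega) h) (by omega)

theorem bernoulli_mem (hp : p.Prime) {n : ℕ} (hn : n + 1 < p) :
    bernoulli n ∈ padicIntegral p hp := by
  rw [bernoulli]
  exact Subring.mul_mem _
    (Subring.pow_mem _ (Subring.neg_mem _ (Subring.one_mem _)) _) (bernoulli'_mem hp hn)

theorem bernoulli_eval_congr (hp : p.Prime) {n : ℕ} (hn : n + 1 < p) {x y : ℚ}
    (hy : y ∈ padicIntegral p hp) (h : PadicCongr p 1 x y) :
    PadicCongr p 1 ((Polynomial.bernoulli n).eval x) ((Polynomial.bernoulli n).eval y) := by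
  simp only [Polynomial.bernoulli, Polynomial.eval_finsetSum, Polynomial.eval_monomial]
  refine PadicCongr.sum hp fun i hi => ?_
  rw [Finset.mem_range] at hi
  refine (h.pow hp hy _).mul_left hp (Subring.mul_mem _ (bernoulli_mem hp (by omega)) ?_)
  exact natCast_mem _ _

/-- Sums of `(p - 3)`-rd powers modulo `p` in terms of a value of a Bernoulli polynomial. -/
theorem two_mul_sum_pow_congr (hp : p.Prime) (hp3 : 3 < p) {N : ℕ} (hN0 : ¬ p ∣ N)
    (hN : p % N = 1) :
    PadicCongr p 1 (2 * ((∑ i ∈ Finset.range ((p - 1) / N + 1), i ^ (p - 3) : ℕ) : ℚ))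
      ((Polynomial.bernoulli (p - 2)).eval (1 / N : ℚ)) := by
  have hodd := hp.odd_of_ne_two (by omega)
  have hoddk : Odd (p - 2) := by
    rcases hodd with ⟨k, hk⟩
    exact ⟨k - 1, by omega⟩
  have hNq : (N : ℚ) ≠ 0 := by
    intro h
    rw [Nat.cast_eq_zero] at h
    subst h
    exact hN0 (dvd_zero p)
  -- Faulhaber's formula; its constant B_{p-2} vanishes because p - 2 is odd and greater than 1.
  have h1 := Polynomial.sum_range_pow_eq_bernoulli_sub ((p - 1) / N + 1) (p - 3)
  rw [show (p - 3).succ = p - 2 by omega, bernoulli_eq_zero_of_odd hoddk (by omega), sub_zero] at h1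
  have hdvd : N * ((p - 1) / N) = p - 1 := by
    apply Nat.mul_div_cancel'
    have := Nat.div_add_mod p N
    exact ⟨p / N, by omega⟩
  have hdvdq : (N : ℚ) * (((p - 1) / N : ℕ) : ℚ) = p - 1 := by
    have := congrArg (fun n : ℕ => (n : ℚ)) hdvd
    push_cast [Nat.cast_sub hp.one_lt.le] at this
    exact this
  have hmem : (N : ℚ)⁻¹ ∈ padicIntegral p hp := inv_natCast_mem hp hN0
  -- With m = (p-1)/N the endpoint m + 1 is 1 - 1/N + p/N. The symmetry B(1-x) = -B(x) in odd degree
  -- and p - 2 ≡ -2 then produce the factor 2.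
  have h2 : PadicCongr p 1 ((((p - 1) / N + 1 : ℕ)) : ℚ) (1 - 1 / N) := by
    refine (padicCongr_iff hp).2 ⟨(N : ℚ)⁻¹, hmem, ?_⟩
    push_cast
    field_simp
    linear_combination hdvdq
  have h3 := bernoulli_eval_congr hp (n := p - 2) (by omega)
    (Subring.sub_mem _ (Subring.one_mem _) (by rw [one_div]; exact hmem)) h2
  rw [Polynomial.bernoulli_eval_one_sub, hoddk.neg_one_pow, ← h1] at h3
  have h4 := h3.mul_left hp (Subring.neg_mem _ (Subring.one_mem _))
  rw [show (-1 : ℚ) * (-1 * (Polynomial.bernoulli (p - 2)).eval (1 / N : ℚ)) =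
    (Polynomial.bernoulli (p - 2)).eval (1 / N : ℚ) by ring] at h4
  refine PadicCongr.trans hp ?_ h4
  refine (padicCongr_iff hp).2
    ⟨((∑ i ∈ Finset.range ((p - 1) / N + 1), i ^ (p - 3) : ℕ) : ℚ), natCast_mem _ _, ?_⟩
  push_cast [Nat.cast_sub hp3.le]
  ring

/-- After rescaling t to 4t, the difference of the Bernoulli generating functions at 3/4 and 1/4 is
4t(e^(3t) - e^t)/(e^(4t) - 1) = 4t e^t/(e^(2t) + 1), that is 2t times the Euler generating function.
The coefficients of t^(k+1) are compared. -/
theorem two_mul_succ_mul_eulerNumber (k : ℕ) :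
    2 * ((k : ℚ) + 1) * eulerNumber k = 4 ^ (k + 1) *
      ((Polynomial.bernoulli (k + 1)).eval (3 / 4 : ℚ) -
        (Polynomial.bernoulli (k + 1)).eval (1 / 4 : ℚ)) := by
  have hgen : ∀ t : ℚ, PowerSeries.rescale (4 : ℚ) (PowerSeries.mk fun n =>
        Polynomial.aeval t ((1 / (n.factorial : ℚ)) • Polynomial.bernoulli n)) *
      (PowerSeries.exp ℚ ^ 4 - 1) =
      4 * PowerSeries.X * PowerSeries.rescale (4 * t) (PowerSeries.exp ℚ) := by
    intro t
    have h := congrArg (PowerSeries.rescale (4 : ℚ)) (Polynomial.bernoulli_generating_function t)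
    rw [map_mul, map_mul, map_sub, map_one, PowerSeries.rescale_X,
      PowerSeries.rescale_rescale] at h
    have h4 := PowerSeries.exp_pow_eq_rescale_exp (A := ℚ) 4
    push_cast at h4
    rw [← h4, mul_comm t 4] at h
    rw [h]
    rfl
  have h3 := hgen (3 / 4)
  have h1 := hgen (1 / 4)
  have e3 := PowerSeries.exp_pow_eq_rescale_exp (A := ℚ) 3
  have e2 := PowerSeries.exp_pow_eq_rescale_exp (A := ℚ) 2
  push_cast at e3 e2
  rw [show (4 : ℚ) * (3 / 4) = 3 by norm_num, ← e3] at h3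
  rw [show (4 : ℚ) * (1 / 4) = 1 by norm_num, PowerSeries.rescale_one, RingHom.id_apply] at h1
  set A := PowerSeries.rescale (4 : ℚ) (PowerSeries.mk fun n =>
    Polynomial.aeval (3 / 4 : ℚ) ((1 / (n.factorial : ℚ)) • Polynomial.bernoulli n)) with hA
  set B := PowerSeries.rescale (4 : ℚ) (PowerSeries.mk fun n =>
    Polynomial.aeval (1 / 4 : ℚ) ((1 / (n.factorial : ℚ)) • Polynomial.bernoulli n)) with hB
  set F := (2 * PowerSeries.exp ℚ *
    (PowerSeries.rescale (2 : ℚ) (PowerSeries.exp ℚ) + 1)⁻¹) with hF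
  have hFe : F * (PowerSeries.exp ℚ ^ 2 + 1) = 2 * PowerSeries.exp ℚ := by
    rw [hF, e2, mul_assoc, PowerSeries.inv_mul_cancel, mul_one]
    rw [← e2]
    simp
  have hne : (PowerSeries.exp ℚ ^ 4 - 1 : PowerSeries ℚ) ≠ 0 := by
    intro h
    have h4 := PowerSeries.exp_pow_eq_rescale_exp (A := ℚ) 4
    have := congrArg (PowerSeries.coeff 1) h
    rw [h4] at this
    simp [PowerSeries.coeff_rescale, PowerSeries.coeff_exp, PowerSeries.coeff_one] at this
  have key : A - B = 2 * (PowerSeries.X * F) := by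
    refine mul_right_cancel₀ hne ?_
    linear_combination h3 - h1 - 2 * PowerSeries.X * (PowerSeries.exp ℚ ^ 2 - 1) * hFe
  have hc := congrArg (PowerSeries.coeff (k + 1)) key
  rw [map_sub, hA, hB, PowerSeries.coeff_rescale, PowerSeries.coeff_rescale,
    PowerSeries.coeff_mk, PowerSeries.coeff_mk,
    show (2 : PowerSeries ℚ) = PowerSeries.C (2 : ℚ) from (map_ofNat (PowerSeries.C (R := ℚ)) 2).symm, PowerSeries.coeff_C_mul,
    PowerSeries.coeff_succ_X_mul] at hc
  simp only [map_smul, Polynomial.coe_aeval_eq_eval, smul_eq_mul] at hc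
  rw [eulerNumber, ← hF]
  have hk : ((k.factorial : ℕ) : ℚ) ≠ 0 := by exact_mod_cast k.factorial_ne_zero
  rw [Nat.factorial_succ] at hc
  push_cast at hc
  have hk1 : (k : ℚ) + 1 ≠ 0 := by positivity
  generalize PowerSeries.coeff k F = f at *
  field_simp at hc
  linear_combination -hc

theorem sum_pow_congr_eulerNumber (hp : p.Prime) (hp4 : p % 4 = 1) :
    PadicCongr p 1 ((∑ i ∈ Finset.range ((p - 1) / 4 + 1), i ^ (p - 3) : ℕ) : ℚ)
      (4 * eulerNumber (p - 3)) := by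
  have hp3 : 3 < p := by have := hp.two_le; omega
  have hnd : ∀ r : ℕ, 0 < r → r < p → ¬ p ∣ r := fun r h0 hr h =>
    absurd (Nat.le_of_dvd h0 h) (by omega)
  have hoddk : Odd (p - 2) := ⟨(p - 3) / 2, by omega⟩
  have h1 := two_mul_sum_pow_congr hp hp3 (N := 4) (hnd 4 (by omega) (by omega)) hp4
  have h2 := two_mul_succ_mul_eulerNumber (p - 3)
  rw [show p - 3 + 1 = p - 2 by omega] at h2
  have h3 := Polynomial.bernoulli_eval_one_sub (p - 2) (1 / 4)
  rw [hoddk.neg_one_pow, show (1 - 1 / 4 : ℚ) = 3 / 4 by norm_num] at h3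
  rw [h3] at h2
  push_cast [Nat.cast_sub hp3.le] at h1 h2
  have hfermat : PadicCongr p 1 ((4 : ℤ) * 4 ^ (p - 2) : ℤ) (1 : ℤ) := by
    apply PadicCongr.of_zmod hp
    have := Fact.mk hp
    have h4 := ZMod.pow_card_sub_one_eq_one
      (natCast_ne_zero_of_lt (p := p) (r := 4) (by omega) (by omega))
    rw [pow_one]
    push_cast at h4 ⊢
    rw [← pow_succ', show p - 2 + 1 = p - 1 by omega]
    exact h4
  push_cast at hfermat
  have hm2 : (2 : ℚ)⁻¹ ∈ padicIntegral p hp := inv_natCast_mem hp (hnd 2 (by omega) (by omega))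
  have hmp : ((p : ℚ) - 2)⁻¹ ∈ padicIntegral p hp := by
    have := inv_natCast_mem hp (hnd (p - 2) (by omega) (by omega))
    rwa [Nat.cast_sub (by omega)] at this
  have hp2 : (p : ℚ) - 2 ≠ 0 := by
    have : (3 : ℚ) < p := by exact_mod_cast hp3
    linarith
  have hBmem : (Polynomial.bernoulli (p - 2)).eval (1 / 4 : ℚ) ∈ padicIntegral p hp := by
    refine PadicCongr.mem hp (h1.symm hp) ?_
    refine Subring.mul_mem _ (natCast_mem _ 2) (Subring.sum_mem _ fun i _ => ?_)
    exact Subring.pow_mem _ (natCast_mem _ i) _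
  -- B_{p-2}(3/4) = -B_{p-2}(1/4) merges the two values. Since 4 · 4^(p-2) ≡ 1 and -1/(p-2) ≡ 1/2,
  -- the right side reduces to B_{p-2}(1/4)/2.
  have hE : (4 : ℚ) * eulerNumber (p - 3) =
      (-((Polynomial.bernoulli (p - 2)).eval (1 / 4 : ℚ)) * ((p : ℚ) - 2)⁻¹) *
        (4 * 4 ^ (p - 2)) := by
    field_simp
    linear_combination h2 / 2
  push_cast
  have h5 := h1.mul_left hp hm2
  rw [← mul_assoc, inv_mul_cancel₀ two_ne_zero, one_mul] at h5
  refine h5.trans hp ?_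
  rw [hE]
  have h6 := hfermat.mul_left hp (Subring.mul_mem _ (Subring.neg_mem _ hBmem) hmp)
  refine PadicCongr.trans hp ?_ (h6.symm hp)
  refine (padicCongr_iff hp).2 ⟨2⁻¹ * ((p : ℚ) - 2)⁻¹ *
    (Polynomial.bernoulli (p - 2)).eval (1 / 4 : ℚ),
    Subring.mul_mem _ (Subring.mul_mem _ hm2 hmp) hBmem, ?_⟩
  field_simp
  ring

end Bernoulli

/-! ### Closed forms of the four sums -/

section Telescoping

theorem sum_range_succ_eq_of_telescoping {t g : ℕ → ℚ} (h0 : t 0 = g 0)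
    (h : ∀ n, g n + t (n + 1) = g (n + 1)) (n : ℕ) :
    ∑ k ∈ Finset.range (n + 1), t k = g n := by
  induction n with
  | zero => simpa using h0
  | succ n ih => rw [Finset.sum_range_succ, ih, h]

theorem cast_choose_mul_factorial {n k l : ℕ} (h : n = k + l) :
    ((n.choose k : ℕ) : ℚ) = n.factorial / (k.factorial * l.factorial) := by
  subst h
  exact Nat.cast_add_choose ℚ

/-- Rewriting (2n+1)^2 c_n as R(n+1) c_{n+1} with R(k) = k(2k-1)/2 turns the difference of
consecutive closed forms into (2k+1)^2 - d R(k), which is the given quadratic. The other three sums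
work alike, each from its own `hrec`. -/
theorem sum_choose_two_mul {d : ℚ} (hd : d ≠ 0) (n : ℕ) :
    ∑ k ∈ Finset.range (n + 1),
        (1 + (4 - d) * (k : ℚ) ^ 2 + (8 + d) / 2 * (k : ℚ)) * ((2 * k).choose k : ℚ) / d ^ k =
      (2 * n + 1) ^ 2 * ((2 * n).choose n : ℚ) / d ^ n := by
  refine sum_range_succ_eq_of_telescoping
    (g := fun n => (2 * n + 1) ^ 2 * ((2 * n).choose n : ℚ) / d ^ n) (by simp) (fun n => ?_) n
  have hrec : ((n : ℚ) + 1) * ((2 * (n + 1)).choose (n + 1) : ℚ) =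
      2 * (2 * n + 1) * ((2 * n).choose n : ℚ) := by
    rw [cast_choose_mul_factorial (show 2 * (n + 1) = (n + 1) + (n + 1) by ring),
      cast_choose_mul_factorial (show 2 * n = n + n by ring), show 2 * (n + 1) = 2 * n + 1 + 1 by ring]
    simp only [Nat.factorial_succ]
    push_cast
    field_simp
    ring
  push_cast at hrec ⊢
  generalize ((2 * (n + 1)).choose (n + 1) : ℚ) = c' at *
  generalize ((2 * n).choose n : ℚ) = c at *
  field_simp
  ring_nf at hrec ⊢
  linear_combination (-d * d ^ n * (2 * n + 1)) * hrec

theorem sum_choose_three_mul {d : ℚ} (hd : d ≠ 0) (n : ℕ) :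
    ∑ k ∈ Finset.range (n + 1),
        (1 + (27 - 4 * d) / 6 * (k : ℚ) ^ 2 + (27 + 2 * d) / 6 * (k : ℚ)) *
          ((3 * k).choose k : ℚ) / d ^ k =
      (3 * n + 1) * (3 * n + 2) / 2 * ((3 * n).choose n : ℚ) / d ^ n := by
  refine sum_range_succ_eq_of_telescoping
    (g := fun n => (3 * n + 1) * (3 * n + 2) / 2 * ((3 * n).choose n : ℚ) / d ^ n)
    (by simp) (fun n => ?_) n
  have hrec : 2 * ((n : ℚ) + 1) * (2 * n + 1) * ((3 * (n + 1)).choose (n + 1) : ℚ) =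
      3 * (3 * n + 1) * (3 * n + 2) * ((3 * n).choose n : ℚ) := by
    rw [cast_choose_mul_factorial (show 3 * (n + 1) = (n + 1) + (2 * n + 1 + 1) by ring),
      cast_choose_mul_factorial (show 3 * n = n + 2 * n by ring),
      show 3 * (n + 1) = 3 * n + 1 + 1 + 1 by ring]
    simp only [Nat.factorial_succ]
    push_cast
    field_simp
    ring
  push_cast at hrec ⊢
  generalize ((3 * (n + 1)).choose (n + 1) : ℚ) = c' at *
  generalize ((3 * n).choose n : ℚ) = c at *
  field_simp
  ring_nf at hrec ⊢
  linear_combination (-2 * d * d ^ n) * hrec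

theorem sum_choose_four_mul {d : ℚ} (hd : d ≠ 0) (n : ℕ) :
    ∑ k ∈ Finset.range (n + 1),
        (1 + (16 - d) / 3 * (k : ℚ) ^ 2 + (32 + d) / 6 * (k : ℚ)) *
          ((4 * k).choose (2 * k) : ℚ) / d ^ k =
      (4 * n + 1) * (4 * n + 3) / 3 * ((4 * n).choose (2 * n) : ℚ) / d ^ n := by
  refine sum_range_succ_eq_of_telescoping
    (g := fun n => (4 * n + 1) * (4 * n + 3) / 3 * ((4 * n).choose (2 * n) : ℚ) / d ^ n)
    (by simp) (fun n => ?_) n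
  have hrec : ((n : ℚ) + 1) * (2 * n + 1) * ((4 * (n + 1)).choose (2 * (n + 1)) : ℚ) =
      2 * (4 * n + 1) * (4 * n + 3) * ((4 * n).choose (2 * n) : ℚ) := by
    rw [cast_choose_mul_factorial (show 4 * (n + 1) = 2 * (n + 1) + 2 * (n + 1) by ring),
      cast_choose_mul_factorial (show 4 * n = 2 * n + 2 * n by ring),
      show 4 * (n + 1) = 4 * n + 1 + 1 + 1 + 1 by ring, show 2 * (n + 1) = 2 * n + 1 + 1 by ring]
    simp only [Nat.factorial_succ]
    push_cast
    field_simp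
    ring
  push_cast at hrec ⊢
  generalize ((4 * (n + 1)).choose (2 * (n + 1)) : ℚ) = c' at *
  generalize ((4 * n).choose (2 * n) : ℚ) = c at *
  field_simp
  ring_nf at hrec ⊢
  linear_combination (-3 * d * d ^ n) * hrec

theorem sum_choose_six_mul {d : ℚ} (hd : d ≠ 0) (n : ℕ) :
    ∑ k ∈ Finset.range (n + 1),
        (1 + (108 - d) / 15 * (k : ℚ) ^ 2 + (216 + d) / 30 * (k : ℚ)) *
          (((6 * k).choose (3 * k) : ℚ) * ((3 * k).choose k : ℚ)) /
            (d ^ k * ((2 * k).choose k : ℚ)) =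
      (6 * n + 1) * (6 * n + 5) / 5 *
        (((6 * n).choose (3 * n) : ℚ) * ((3 * n).choose n : ℚ) / ((2 * n).choose n : ℚ)) /
          d ^ n := by
  refine sum_range_succ_eq_of_telescoping
    (g := fun n => (6 * n + 1) * (6 * n + 5) / 5 *
        (((6 * n).choose (3 * n) : ℚ) * ((3 * n).choose n : ℚ) / ((2 * n).choose n : ℚ)) /
          d ^ n)
    (by simp) (fun n => ?_) n
  have hrec : ((n : ℚ) + 1) * (2 * n + 1) * (((6 * (n + 1)).choose (3 * (n + 1)) : ℚ) *
        ((3 * (n + 1)).choose (n + 1) : ℚ) / ((2 * (n + 1)).choose (n + 1) : ℚ)) =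
      6 * (6 * n + 1) * (6 * n + 5) * (((6 * n).choose (3 * n) : ℚ) * ((3 * n).choose n : ℚ) /
        ((2 * n).choose n : ℚ)) := by
    rw [cast_choose_mul_factorial (show 6 * (n + 1) = 3 * (n + 1) + 3 * (n + 1) by ring),
      cast_choose_mul_factorial (show 3 * (n + 1) = (n + 1) + 2 * (n + 1) by ring),
      cast_choose_mul_factorial (show 2 * (n + 1) = (n + 1) + (n + 1) by ring),
      cast_choose_mul_factorial (show 6 * n = 3 * n + 3 * n by ring),
      cast_choose_mul_factorial (show 3 * n = n + 2 * n by ring),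
      cast_choose_mul_factorial (show 2 * n = n + n by ring),
      show 6 * (n + 1) = 6 * n + 1 + 1 + 1 + 1 + 1 + 1 by ring,
      show 3 * (n + 1) = 3 * n + 1 + 1 + 1 by ring, show 2 * (n + 1) = 2 * n + 1 + 1 by ring]
    simp only [Nat.factorial_succ]
    push_cast
    field_simp
    ring
  have hsplit : ∀ x a b c : ℚ, x * a / (b * c) = x * (a / c) / b := by
    intro x a b c
    rw [mul_div_assoc, mul_div_assoc, mul_comm b c, div_mul_eq_div_div]
  rw [hsplit]
  push_cast at hrec ⊢
  generalize ((6 * (n + 1)).choose (3 * (n + 1)) : ℚ) * ((3 * (n + 1)).choose (n + 1) : ℚ) /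
    ((2 * (n + 1)).choose (n + 1) : ℚ) = c' at *
  generalize ((6 * n).choose (3 * n) : ℚ) * ((3 * n).choose n : ℚ) / ((2 * n).choose n : ℚ) = c at *
  field_simp
  ring_nf at hrec ⊢
  linear_combination (-75 * d * d ^ n) * hrec

end Telescoping

/-! ### Extracting the factor p = 2n + 1, and reductions modulo p -/

section Evaluation

variable {p : ℕ}

theorem three_mul_add_one_mul_choose (n : ℕ) :
    (3 * (n : ℚ) + 1) * ((3 * n).choose n : ℚ) =
      (2 * n + 1) * ((2 * n + 1 + n).choose n : ℚ) := by
  rw [cast_choose_mul_factorial (show 3 * n = n + 2 * n by ring),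
    cast_choose_mul_factorial (show 2 * n + 1 + n = n + (2 * n + 1) by ring),
    show 2 * n + 1 + n = 3 * n + 1 by ring]
  simp only [Nat.factorial_succ]
  push_cast
  field_simp

theorem four_mul_add_one_mul_choose (n : ℕ) :
    (4 * (n : ℚ) + 1) * ((4 * n).choose (2 * n) : ℚ) =
      (2 * n + 1) * ((2 * (2 * n + 1) - 1).choose (2 * n) : ℚ) := by
  rw [show 2 * (2 * n + 1) - 1 = 4 * n + 1 by omega,
    cast_choose_mul_factorial (show 4 * n = 2 * n + 2 * n by ring),
    cast_choose_mul_factorial (show 4 * n + 1 = 2 * n + (2 * n + 1) by ring)]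
  simp only [Nat.factorial_succ]
  push_cast
  field_simp

theorem six_mul_add_one_mul_choose (n : ℕ) :
    (6 * (n : ℚ) + 1) *
        (((6 * n).choose (3 * n) : ℚ) * ((3 * n).choose n : ℚ) / ((2 * n).choose n : ℚ)) *
        ((2 * n + 1 + n).choose n : ℚ) =
      (2 * n + 1) * ((2 * (2 * n + 1) - 1).choose (2 * n) : ℚ) *
        ((3 * (2 * n + 1) - 1).choose (2 * n) : ℚ) := by
  rw [show 2 * (2 * n + 1) - 1 = 4 * n + 1 by omega,
    show 3 * (2 * n + 1) - 1 = 6 * n + 1 + 1 by omega,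
    cast_choose_mul_factorial (show 6 * n = 3 * n + 3 * n by ring),
    cast_choose_mul_factorial (show 3 * n = n + 2 * n by ring),
    cast_choose_mul_factorial (show 2 * n = n + n by ring),
    cast_choose_mul_factorial (show 2 * n + 1 + n = n + (2 * n + 1) by ring),
    cast_choose_mul_factorial (show 4 * n + 1 = 2 * n + (2 * n + 1) by ring),
    cast_choose_mul_factorial (show 6 * n + 1 + 1 = 2 * n + (4 * n + 1 + 1) by ring),
    show 2 * n + 1 + n = 3 * n + 1 by ring]
  simp only [Nat.factorial_succ]
  push_cast
  field_simp
  ring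

theorem inv_mem_of_not_dvd_num (hp : p.Prime) {d : ℚ} (hd : d ≠ 0) (hpd : ¬ (p : ℤ) ∣ d.num) :
    d⁻¹ ∈ padicIntegral p hp := by
  change ¬ p ∣ (d⁻¹).den
  rw [Rat.den_inv_of_ne_zero hd]
  rwa [← Int.natCast_dvd]

theorem not_dvd_choose_prime_sub_one (hp : p.Prime) {m : ℕ} (hm : m ≤ p - 1) :
    ¬ p ∣ (p - 1).choose m := by
  intro h
  have h1 := Nat.choose_mul_factorial_mul_factorial hm
  have h2 : p ∣ (p - 1).factorial := by
    rw [← h1, mul_assoc]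
    exact h.mul_right _
  rw [hp.dvd_factorial] at h2
  have := hp.pos
  omega

theorem intCast_zmod_eq_of_cube {a b : ℤ}
    (h : (a : ZMod (p ^ 3)) = (b : ZMod (p ^ 3))) : (a : ZMod p) = (b : ZMod p) := by
  rw [ZMod.intCast_eq_intCast_iff_dvd_sub] at h ⊢
  exact (Int.natCast_dvd_natCast.2 (dvd_pow_self p (by norm_num))).trans h

theorem natCast_pow_sub_one (hp : p.Prime) {a : ℕ} (h0 : ¬ p ∣ a) :
    (a : ZMod p) ^ (p - 1) = 1 := by
  have := Fact.mk hp
  exact ZMod.pow_card_sub_one_eq_one (by rwa [Ne, ZMod.natCast_eq_zero_iff])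

theorem choose_add_half_zmod (hp : p.Prime) (hp3 : 3 < p) :
    ((p + (p - 1) / 2).choose ((p - 1) / 2) : ZMod p) = 1 := by
  have h := choose_add_half hp hp3
  have h2 := intCast_zmod_eq_of_cube (p := p)
    (a := ((p + (p - 1) / 2).choose ((p - 1) / 2) : ℤ) * 4 ^ (p - 1)) (b := 1)
    (by push_cast; exact h)
  have h4 := natCast_pow_sub_one hp (a := 2 ^ 2)
    (fun h => by have := Nat.le_of_dvd (by norm_num) (hp.dvd_of_dvd_pow h); omega)
  push_cast at h2 h4
  rwa [h4, mul_one] at h2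

theorem choose_two_mul_sub_one_zmod (hp : p.Prime) (hp3 : 3 < p) :
    ((2 * p - 1).choose (p - 1) : ZMod p) = 1 := by
  have h2 := intCast_zmod_eq_of_cube (p := p) (a := ((2 * p - 1).choose (p - 1) : ℤ)) (b := 1)
    (by push_cast; exact choose_two_mul_sub_one hp hp3)
  push_cast at h2
  exact h2

theorem choose_three_mul_sub_one_zmod (hp : p.Prime) (hp3 : 3 < p) :
    ((3 * p - 1).choose (p - 1) : ZMod p) = 1 := by
  have h2 := intCast_zmod_eq_of_cube (p := p) (a := ((3 * p - 1).choose (p - 1) : ℤ)) (b := 1)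
    (by push_cast; exact choose_three_mul_sub_one hp hp3)
  push_cast at h2
  exact h2

/-- Lucas: the base p digits are (1, r) and (1, 1), so the binomial is C(1,1) C(r,1). -/
theorem choose_prime_add (hp : p.Prime) {r : ℕ} (hr : r < p) :
    ((p + r).choose (p + 1) : ZMod p) = r := by
  have := Fact.mk hp
  have h := Choose.choose_modEq_choose_mod_mul_choose_div_nat (n := p + r) (k := p + 1) (p := p)
  rw [← ZMod.natCast_eq_natCast_iff] at h
  rw [h, Nat.add_mod_left, Nat.add_mod_left, Nat.add_div_left _ hp.pos, Nat.add_div_left _ hp.pos,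
    Nat.mod_eq_of_lt hr, Nat.mod_eq_of_lt hp.one_lt, Nat.div_eq_of_lt hr,
    Nat.div_eq_of_lt hp.one_lt]
  simp

theorem not_dvd_of_lt {r : ℕ} (h0 : 0 < r) (hr : r < p) : ¬ p ∣ r := fun h =>
  absurd (Nat.le_of_dvd h0 h) (by omega)

theorem PadicCongr.of_zmod_prime (hp : p.Prime) {a b : ℤ}
    (h : (a : ZMod p) = (b : ZMod p)) : PadicCongr p 1 (a : ℚ) (b : ℚ) := by
  apply PadicCongr.of_zmod hp
  rw [ZMod.intCast_eq_intCast_iff_dvd_sub] at h ⊢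
  rwa [pow_one]

/-- If `A ≡ B (mod p ^ k)`, then `p ^ l * u * A ≡ p ^ l * u * B (mod p ^ (l + k))` for integral `u`. -/
theorem PadicCongr.scale (hp : p.Prime) {k : ℕ} (l : ℕ) {u A B X Y : ℚ}
    (hu : u ∈ padicIntegral p hp) (h : PadicCongr p k A B)
    (hX : X = (p : ℚ) ^ l * (u * A)) (hY : Y = (p : ℚ) ^ l * (u * B)) :
    PadicCongr p (l + k) X Y := by
  rw [hX, hY]
  exact (h.mul_left hp hu).pow_mul hp l

end Evaluation

/-! ### The seven congruences -/

section Congruences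

variable {p : ℕ} {d : ℚ}

theorem sum_choose_two_mul_congr (hp : p.Prime) (hp3 : 3 < p) (hd : d ≠ 0)
    (hpd : ¬ (p : ℤ) ∣ d.num) :
    PadicCongr p 5
      (∑ k ∈ Finset.range ((p - 1) / 2 + 1),
        (1 + (4 - d) * (k : ℚ) ^ 2 + (8 + d) / 2 * (k : ℚ)) * ((2 * k).choose k : ℚ) / d ^ k)
      ((-1 / d) ^ ((p - 1) / 2) * (p : ℚ) ^ 2 *
        (1 + 2 * (p : ℚ) * fermatQuotient p 2 + (p : ℚ) ^ 2 * fermatQuotient p 2 ^ 2)) := by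
  have hdm := inv_mem_of_not_dvd_num hp hd hpd
  have hodd := hp.odd_of_ne_two (by omega)
  obtain ⟨n, hn⟩ := hodd
  have hn2 : (p - 1) / 2 = n := by omega
  have hpn : (p : ℚ) = 2 * n + 1 := by rw [hn]; push_cast; ring
  have h := choose_half hp hp3
  rw [hn2] at h ⊢
  rw [sum_choose_two_mul hd]
  have hp0 : (p : ℚ) ≠ 0 := by exact_mod_cast hp.ne_zero
  have hq : (p : ℚ) * fermatQuotient p 2 = 2 ^ (p - 1) - 1 := by
    rw [fermatQuotient]
    field_simp
    norm_num
  have h4 : (4 : ℚ) ^ (p - 1) = (2 ^ (p - 1)) ^ 2 := by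
    rw [← pow_mul, mul_comm, pow_mul]; norm_num
  refine PadicCongr.scale hp 2 (Subring.pow_mem _ hdm n) (PadicCongr.of_zmod hp (k := 3)
    (a := ((p - 1).choose n : ℤ)) (b := (-1) ^ n * 4 ^ (p - 1)) (by push_cast; exact h)) ?_ ?_
  · rw [← hpn, show 2 * n = p - 1 by omega, inv_pow]
    push_cast
    ring
  · rw [neg_div, neg_pow, one_div]
    push_cast
    rw [h4]
    linear_combination ((-1) ^ n * (d⁻¹) ^ n * (p : ℚ) ^ 2 *
      ((p : ℚ) * fermatQuotient p 2 + 2 ^ (p - 1) + 1)) * hq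

/-- The sum is p(3p+1)/4 · C(p+n, n)/d^n. Multiplied by C(p-1, (p-1)/6) from the denominator of the
claim, the factor C(p+n, n) ≡ 4^(-(p-1)) cancels the power of 4 in `choose_sixth`, leaving 27^n (1 -
p^2 S/3). -/
theorem sum_choose_three_mul_congr_one (hp : p.Prime) (hp3 : 3 < p) (hd : d ≠ 0)
    (hpd : ¬ (p : ℤ) ∣ d.num) (h : p % 3 = 1) :
    PadicCongr p 4
      (∑ k ∈ Finset.range ((p - 1) / 2 + 1),
        (1 + (27 - 4 * d) / 6 * (k : ℚ) ^ 2 + (27 + 2 * d) / 6 * (k : ℚ)) *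
          ((3 * k).choose k : ℚ) / d ^ k)
      ((-1) ^ ((p - 1) / 3) * (27 / d) ^ ((p - 1) / 2) /
          (4 * ((p - 1).choose ((5 * p - 5) / 6) : ℚ)) *
        ((p : ℚ) + 3 * (p : ℚ) ^ 2 -
          (p : ℚ) ^ 3 / 6 * (jacobiSym p 3 : ℚ) *
            (Polynomial.bernoulli (p - 2)).eval (1 / 6 : ℚ))) := by
  have hdm := inv_mem_of_not_dvd_num hp hd hpd
  obtain ⟨n, hn⟩ := hp.odd_of_ne_two (by omega)
  have hn2 : (p - 1) / 2 = n := by omega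
  have hpn : (p : ℚ) = 2 * n + 1 := by rw [hn]; push_cast; ring
  have hc := cast_prime_cube p
  have hb := two_mul_sum_pow_congr hp hp3 (N := 6) (not_dvd_of_lt (by omega) (by omega)) (by omega)
  have h6 := choose_sixth hp (by omega)
  have hB := choose_add_half hp hp3
  have hnd := not_dvd_choose_prime_sub_one hp (m := (p - 1) / 6) (by omega)
  have hJ : jacobiSym p 3 = 1 := by
    rw [jacobiSym.mod_left, show (p : ℤ) % (3 : ℕ) = 1 by omega, jacobiSym.one_left]
  have hsymm : (p - 1).choose ((5 * p - 5) / 6) = (p - 1).choose ((p - 1) / 6) := by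
    rw [← Nat.choose_symm (show (p - 1) / 6 ≤ p - 1 by omega)]
    congr 1
    omega
  have hpar : (-1 : ℚ) ^ ((p - 1) / 3) = 1 := Even.neg_one_pow ⟨(p - 1) / 6, by omega⟩
  rw [hn2] at hB h6 ⊢
  rw [sum_choose_three_mul hd, hsymm, hpar, hJ]
  have hX := three_mul_add_one_mul_choose n
  rw [← hn] at hX
  generalize (∑ i ∈ Finset.range ((p - 1) / 6 + 1), i ^ (p - 3)) = S at *
  generalize (p - 1).choose ((p - 1) / 6) = C at *
  generalize (p + n).choose n = Bn at *
  generalize (3 * n).choose n = A at *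
  push_cast at hb
  generalize (Polynomial.bernoulli (p - 2)).eval (1 / 6 : ℚ) = b at *
  -- The claim cleared of denominators; in the S term the factor 3p + 1 counts as 1 since p^3 = 0.
  have hL : PadicCongr p 3 ((6 * (3 * p + 1) * Bn * C : ℤ) : ℚ)
      ((27 ^ n * (6 + 18 * p - 2 * p ^ 2 * S) : ℤ) : ℚ) := by
    apply PadicCongr.of_zmod hp
    push_cast
    linear_combination 2 * (3 * (p : ZMod (p ^ 3)) + 1) * Bn * h6 +
      2 * (3 * (p : ZMod (p ^ 3)) + 1) * 27 ^ n * (3 - (p : ZMod (p ^ 3)) ^ 2 * S) * hB -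
      6 * 27 ^ n * S * hc
  have hM : PadicCongr p 3 (27 ^ n * (6 + 18 * p - 2 * p ^ 2 * S))
      (27 ^ n * (6 + 18 * p - p ^ 2 * b)) := by
    have := ((hb.pow_mul hp 2).mul_left hp (c := -27 ^ n)
      (Subring.neg_mem _ (Subring.pow_mem _ (natCast_mem _ 27) n))).add hp
      (PadicCongr.refl hp 3 (27 ^ n * (6 + 18 * p)))
    convert this using 1 <;> ring
  push_cast at hL
  have hC0 : (C : ℚ) ≠ 0 := by
    intro h; rw [Nat.cast_eq_zero] at h; rw [h] at hnd; exact hnd (dvd_zero p)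
  have hu := Subring.mul_mem _ (Subring.pow_mem _ hdm n)
    (inv_natCast_mem hp (r := 24 * C) (fun h => by
      rcases hp.dvd_mul.1 h with h | h
      · have h2 : p ∣ 2 ^ 3 * 3 := h
        rcases hp.dvd_mul.1 h2 with h | h
        · exact not_dvd_of_lt (by omega) (by omega) (hp.dvd_of_dvd_pow h)
        · exact not_dvd_of_lt (by omega) (by omega) h
      · exact hnd h))
  refine PadicCongr.scale hp 1 hu (hL.trans hp hM) ?_ ?_
  · rw [pow_one, inv_pow]
    push_cast
    field_simp
    rw [hpn]
    linear_combination 24 * (3 * (n : ℚ) + 2) * hX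
  · rw [pow_one, div_pow, inv_pow]
    push_cast
    field_simp
    ring

/-- After removing p, only residues modulo p matter: C(p+n, n) ≡ 1, the binomial on the right is r ≡
1/6, and (-27)^n ≡ (-3)^n ≡ -1 as p ≡ 2 mod 3. -/
theorem sum_choose_three_mul_congr_two (hp : p.Prime) (hp3 : 3 < p) (hd : d ≠ 0)
    (hpd : ¬ (p : ℤ) ∣ d.num) (h : p % 3 = 2) :
    PadicCongr p 2
      (∑ k ∈ Finset.range ((p - 1) / 2 + 1),
        (1 + (27 - 4 * d) / 6 * (k : ℚ) ^ 2 + (27 + 2 * d) / 6 * (k : ℚ)) *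
          ((3 * k).choose k : ℚ) / d ^ k)
      (-(3 / 2) * (-27 / d) ^ ((p - 1) / 2) * (p : ℚ) *
        (((7 * p + 1) / 6).choose (p + 1) : ℚ)) := by
  have hdm := inv_mem_of_not_dvd_num hp hd hpd
  obtain ⟨n, hn⟩ := hp.odd_of_ne_two (by omega)
  have hn2 : (p - 1) / 2 = n := by omega
  have hpn : (p : ℚ) = 2 * n + 1 := by rw [hn]; push_cast; ring
  have hmod : (p : ZMod p) = 0 := ZMod.natCast_self p
  have hB := choose_add_half_zmod hp hp3
  have h3 := neg_three_pow_half hp hp3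
  rw [if_neg (by omega)] at h3
  have h9 := natCast_pow_sub_one hp (a := 3) (not_dvd_of_lt (by omega) (by omega))
  obtain ⟨r, hr⟩ : ∃ r, 6 * r = p + 1 := ⟨(p + 1) / 6, by omega⟩
  have hC := choose_prime_add hp (show r < p by omega)
  rw [show (7 * p + 1) / 6 = p + r by omega]
  have hr' := congrArg (fun n : ℕ => (n : ZMod p)) hr
  rw [show p - 1 = n * 2 by omega, pow_mul'] at h9
  rw [hn2] at hB h3 ⊢
  rw [sum_choose_three_mul hd]
  have hX := three_mul_add_one_mul_choose n
  rw [← hn] at hX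
  generalize (p + n).choose n = Bn at *
  generalize (3 * n).choose n = A at *
  generalize (p + r).choose (p + 1) = C at *
  have hL : PadicCongr p 1 (((3 * p + 1) * Bn : ℤ) : ℚ) ((-6 * (-27) ^ n * C : ℤ) : ℚ) := by
    apply PadicCongr.of_zmod_prime hp
    push_cast at hr' h9 ⊢
    rw [show (-27 : ZMod p) = -3 * 3 ^ 2 by norm_num, mul_pow, h3, hB, hC,
      hmod, h9]
    linear_combination -hr' - hmod
  push_cast at hL
  have hu := Subring.mul_mem _ (Subring.pow_mem _ hdm n)
    (inv_natCast_mem hp (r := 4) (not_dvd_of_lt (by omega) (by omega)))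
  refine PadicCongr.scale hp 1 hu hL ?_ ?_
  · rw [pow_one, inv_pow]
    push_cast
    field_simp
    rw [hpn]
    linear_combination 4 * (3 * (n : ℚ) + 2) * hX
  · rw [pow_one, div_pow, inv_pow]
    push_cast
    field_simp
    ring

/-- The sum is p(2p+1)/3 · C(2p-1, p-1)/d^n. Wolstenholme removes the binomial, and `choose_quarter`
with 8^(p-1) = 64^n evaluates the denominator of the claim. -/
theorem sum_choose_four_mul_congr_one (hp : p.Prime) (hp3 : 3 < p) (hd : d ≠ 0)
    (hpd : ¬ (p : ℤ) ∣ d.num) (h : p % 4 = 1) :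
    PadicCongr p 4
      (∑ k ∈ Finset.range ((p - 1) / 2 + 1),
        (1 + (16 - d) / 3 * (k : ℚ) ^ 2 + (32 + d) / 6 * (k : ℚ)) *
          ((4 * k).choose (2 * k) : ℚ) / d ^ k)
      ((-1) ^ ((p - 1) / 4) * (64 / d) ^ ((p - 1) / 2) /
          (3 * ((p - 1).choose ((3 * p - 3) / 4) : ℚ)) *
        ((p : ℚ) + 2 * (p : ℚ) ^ 2 -
          (-1) ^ ((p - 1) / 2) * (p : ℚ) ^ 3 * eulerNumber (p - 3))) := by
  have hdm := inv_mem_of_not_dvd_num hp hd hpd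
  obtain ⟨n, hn⟩ := hp.odd_of_ne_two (by omega)
  have hn2 : (p - 1) / 2 = n := by omega
  have hpn : (p : ℚ) = 2 * n + 1 := by rw [hn]; push_cast; ring
  have hc := cast_prime_cube p
  have hE := sum_pow_congr_eulerNumber hp h
  have h4 := choose_quarter hp h
  have hW := choose_two_mul_sub_one hp hp3
  have hnd := not_dvd_choose_prime_sub_one hp (m := (p - 1) / 4) (by omega)
  have hsymm : (p - 1).choose ((3 * p - 3) / 4) = (p - 1).choose ((p - 1) / 4) := by
    rw [← Nat.choose_symm (show (p - 1) / 4 ≤ p - 1 by omega)]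
    congr 1
    omega
  have hpar : (-1 : ℚ) ^ ((p - 1) / 2) = 1 := Even.neg_one_pow ⟨(p - 1) / 4, by omega⟩
  have hsgn : ((-1 : ZMod (p ^ 3)) ^ ((p - 1) / 4)) ^ 2 = 1 := by
    rw [← pow_mul, mul_comm, pow_mul]; norm_num
  have h8 : ∀ (R : Type) [CommRing R], (8 : R) ^ (p - 1) = 64 ^ n := by
    intro R _
    rw [show p - 1 = 2 * n by omega, pow_mul]; norm_num
  rw [h8] at h4
  rw [hpar, hn2, sum_choose_four_mul hd, hsymm]
  have hX := four_mul_add_one_mul_choose n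
  rw [← hn, show 2 * n = p - 1 by omega] at hX
  rw [show 2 * n = p - 1 by omega]
  generalize (∑ i ∈ Finset.range ((p - 1) / 4 + 1), i ^ (p - 3)) = S at *
  generalize (p - 1).choose ((p - 1) / 4) = C at *
  generalize (2 * p - 1).choose (p - 1) = W at *
  generalize (4 * n).choose (p - 1) = A at *
  generalize eulerNumber (p - 3) = b at *
  generalize (p - 1) / 4 = m at *
  have hL : PadicCongr p 3 ((4 * (2 * p + 1) * W * C : ℤ) : ℚ)
      (((-1) ^ m * 64 ^ n * (4 + 8 * p - p ^ 2 * S) : ℤ) : ℚ) := by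
    apply PadicCongr.of_zmod hp
    push_cast
    rw [hW]
    linear_combination (-1) ^ m * (2 * (p : ZMod (p ^ 3)) + 1) * h4 -
      4 * (2 * (p : ZMod (p ^ 3)) + 1) * C * hsgn - 2 * (-1) ^ m * 64 ^ n * S * hc
  have hM : PadicCongr p 3 ((-1) ^ m * 64 ^ n * (4 + 8 * p - p ^ 2 * S))
      ((-1) ^ m * 64 ^ n * (4 + 8 * p - p ^ 2 * (4 * b))) := by
    have := ((hE.pow_mul hp 2).mul_left hp (c := -((-1) ^ m * 64 ^ n))
      (Subring.neg_mem _ (Subring.mul_mem _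
        (Subring.pow_mem _ (Subring.neg_mem _ (Subring.one_mem _)) m)
        (Subring.pow_mem _ (natCast_mem _ 64) n)))).add hp
      (PadicCongr.refl hp 3 ((-1) ^ m * 64 ^ n * (4 + 8 * p)))
    convert this using 1 <;> ring
  push_cast at hL
  have hC0 : (C : ℚ) ≠ 0 := by
    intro h; rw [Nat.cast_eq_zero] at h; rw [h] at hnd; exact hnd (dvd_zero p)
  have hu := Subring.mul_mem _ (Subring.pow_mem _ hdm n)
    (inv_natCast_mem hp (r := 12 * C) (fun h => by
      rcases hp.dvd_mul.1 h with h | h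
      · have h2 : p ∣ 2 ^ 2 * 3 := h
        rcases hp.dvd_mul.1 h2 with h | h
        · exact not_dvd_of_lt (by omega) (by omega) (hp.dvd_of_dvd_pow h)
        · exact not_dvd_of_lt (by omega) (by omega) h
      · exact hnd h))
  refine PadicCongr.scale hp 1 hu (hL.trans hp hM) ?_ ?_
  · rw [pow_one, inv_pow]
    push_cast
    field_simp
    rw [hpn]
    linear_combination 12 * (4 * (n : ℚ) + 3) * hX
  · rw [pow_one, div_pow, inv_pow]
    push_cast
    field_simp
    ring

theorem sum_choose_four_mul_congr_three (hp : p.Prime) (hp3 : 3 < p) (hd : d ≠ 0)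
    (hpd : ¬ (p : ℤ) ∣ d.num) (h : p % 4 = 3) :
    PadicCongr p 2
      (∑ k ∈ Finset.range ((p - 1) / 2 + 1),
        (1 + (16 - d) / 3 * (k : ℚ) ^ 2 + (32 + d) / 6 * (k : ℚ)) *
          ((4 * k).choose (2 * k) : ℚ) / d ^ k)
      (-(4 / 3) * (-64 / d) ^ ((p - 1) / 2) * (p : ℚ) *
        (((5 * p + 1) / 4).choose (p + 1) : ℚ)) := by
  have hdm := inv_mem_of_not_dvd_num hp hd hpd
  obtain ⟨n, hn⟩ := hp.odd_of_ne_two (by omega)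
  have hn2 : (p - 1) / 2 = n := by omega
  have hpn : (p : ℚ) = 2 * n + 1 := by rw [hn]; push_cast; ring
  have hmod : (p : ZMod p) = 0 := ZMod.natCast_self p
  have hW := choose_two_mul_sub_one_zmod hp hp3
  have h2 := natCast_pow_sub_one hp (a := 2) (not_dvd_of_lt (by omega) (by omega))
  obtain ⟨r, hr⟩ : ∃ r, 4 * r = p + 1 := ⟨(p + 1) / 4, by omega⟩
  have hC := choose_prime_add hp (show r < p by omega)
  rw [show (5 * p + 1) / 4 = p + r by omega]
  have hr' := congrArg (fun n : ℕ => (n : ZMod p)) hr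
  -- p ≡ 3 mod 4 makes n odd; since 64^n ≡ 1, the sign of (-64)^n is -1.
  have hpar : (-1 : ZMod p) ^ n = -1 := Odd.neg_one_pow ⟨(n - 1) / 2, by omega⟩
  rw [hn2, sum_choose_four_mul hd]
  have h64 : (64 : ZMod p) ^ n = ((2 : ℕ) ^ (p - 1)) ^ 3 := by
    rw [← pow_mul, show (p - 1) * 3 = 6 * n by omega, pow_mul]
    norm_num
  have hX := four_mul_add_one_mul_choose n
  rw [← hn, show 2 * n = p - 1 by omega] at hX
  rw [show 2 * n = p - 1 by omega]
  generalize (2 * p - 1).choose (p - 1) = W at *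
  generalize (4 * n).choose (p - 1) = A at *
  generalize (p + r).choose (p + 1) = C at *
  have hL : PadicCongr p 1 (((2 * p + 1) * W : ℤ) : ℚ) ((-4 * (-64) ^ n * C : ℤ) : ℚ) := by
    apply PadicCongr.of_zmod_prime hp
    push_cast at hr' ⊢
    rw [neg_pow, hpar, h64, h2, hW, hC, hmod]
    linear_combination -hr' - hmod
  push_cast at hL
  have hu := Subring.mul_mem _ (Subring.pow_mem _ hdm n)
    (inv_natCast_mem hp (r := 3) (not_dvd_of_lt (by omega) (by omega)))
  refine PadicCongr.scale hp 1 hu hL ?_ ?_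
  · rw [pow_one, inv_pow]
    push_cast
    field_simp
    rw [hpn]
    linear_combination (4 * (n : ℚ) + 3) * hX
  · rw [pow_one, div_pow, inv_pow]
    push_cast
    field_simp

theorem sum_choose_six_mul_congr_one (hp : p.Prime) (hp3 : 3 < p) (hd : d ≠ 0)
    (hpd : ¬ (p : ℤ) ∣ d.num) (h : p % 6 = 1) :
    PadicCongr p 4
      (∑ k ∈ Finset.range ((p - 1) / 2 + 1),
        (1 + (108 - d) / 15 * (k : ℚ) ^ 2 + (216 + d) / 30 * (k : ℚ)) *
          (((6 * k).choose (3 * k) : ℚ) * ((3 * k).choose k : ℚ)) /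
            (d ^ k * ((2 * k).choose k : ℚ)))
      ((-1) ^ ((p - 1) / 6) * (432 / d) ^ ((p - 1) / 2) /
          (5 * ((p - 1).choose ((2 * p - 2) / 3) : ℚ)) *
        (2 * (p : ℚ) + 3 * (p : ℚ) ^ 2 -
          (p : ℚ) ^ 3 / 30 * (jacobiSym p 3 : ℚ) *
            (Polynomial.bernoulli (p - 2)).eval (1 / 6 : ℚ))) := by
  have hdm := inv_mem_of_not_dvd_num hp hd hpd
  obtain ⟨n, hn⟩ := hp.odd_of_ne_two (by omega)
  have hn2 : (p - 1) / 2 = n := by omega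
  have hpn : (p : ℚ) = 2 * n + 1 := by rw [hn]; push_cast; ring
  have hc := cast_prime_cube p
  have hb := two_mul_sum_pow_congr hp hp3 (N := 6) (not_dvd_of_lt (by omega) (by omega)) (by omega)
  have h3 := choose_third hp h
  have hB := choose_add_half hp hp3
  have hB1 := choose_add_half_zmod hp hp3
  have hW := choose_two_mul_sub_one hp hp3
  have hW2 := choose_three_mul_sub_one hp hp3
  have hnd := not_dvd_choose_prime_sub_one hp (m := (p - 1) / 3) (by omega)
  have hJ : jacobiSym p 3 = 1 := by
    rw [jacobiSym.mod_left, show (p : ℤ) % (3 : ℕ) = 1 by omega, jacobiSym.one_left]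
  have hsymm : (p - 1).choose ((2 * p - 2) / 3) = (p - 1).choose ((p - 1) / 3) := by
    rw [← Nat.choose_symm (show (p - 1) / 3 ≤ p - 1 by omega)]
    congr 1
    omega
  have h432 : (432 : ZMod (p ^ 3)) ^ n = 27 ^ n * 4 ^ (p - 1) := by
    rw [show p - 1 = 2 * n by omega, pow_mul, ← mul_pow]; norm_num
  rw [hn2] at hB hB1 h3 ⊢
  rw [sum_choose_six_mul hd, hsymm, hJ]
  have hX := six_mul_add_one_mul_choose n
  rw [← hn, show 2 * n = p - 1 by omega] at hX
  rw [show 2 * n = p - 1 by omega]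
  generalize (∑ i ∈ Finset.range ((p - 1) / 6 + 1), i ^ (p - 3)) = S at *
  generalize (p - 1).choose ((p - 1) / 3) = C at *
  generalize (p + n).choose n = Bn at *
  generalize (2 * p - 1).choose (p - 1) = W at *
  generalize (3 * p - 1).choose (p - 1) = W' at *
  generalize ((6 * n).choose (3 * n) : ℚ) * ((3 * n).choose n : ℚ) / ((p - 1).choose n : ℚ) = A at *
  push_cast at hb
  generalize (Polynomial.bernoulli (p - 2)).eval (1 / 6 : ℚ) = b at *
  generalize (p - 1) / 6 = m at *
  have hL : PadicCongr p 3 ((30 * (3 * p + 2) * W * W' * C : ℤ) : ℚ)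
      (((-1) ^ m * 432 ^ n * Bn * (60 + 90 * p - 2 * p ^ 2 * S) : ℤ) : ℚ) := by
    apply PadicCongr.of_zmod hp
    push_cast
    rw [hW, hW2, h432]
    -- 432^n = 27^n · 4^(p-1), and C(p+n, n) · 4^(p-1) = 1 absorbs the power of 4.
    linear_combination (3 * (p : ZMod (p ^ 3)) + 2) * h3 -
      (-1) ^ m * 27 ^ n * (60 + 90 * (p : ZMod (p ^ 3)) - 2 * (p : ZMod (p ^ 3)) ^ 2 * S) * hB -
      3 * (-1) ^ m * 27 ^ n * S * hc
  have hM : PadicCongr p 3 ((-1) ^ m * 432 ^ n * Bn * (60 + 90 * p - 2 * p ^ 2 * S))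
      ((-1) ^ m * 432 ^ n * Bn * (60 + 90 * p - p ^ 2 * b)) := by
    have := ((hb.pow_mul hp 2).mul_left hp (c := -((-1) ^ m * 432 ^ n * Bn))
      (Subring.neg_mem _ (Subring.mul_mem _ (Subring.mul_mem _
        (Subring.pow_mem _ (Subring.neg_mem _ (Subring.one_mem _)) m)
        (Subring.pow_mem _ (natCast_mem _ 432) n)) (natCast_mem _ Bn)))).add hp
      (PadicCongr.refl hp 3 ((-1) ^ m * 432 ^ n * Bn * (60 + 90 * p)))
    convert this using 1 <;> ring
  push_cast at hL
  have hC0 : (C : ℚ) ≠ 0 := by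
    intro h; rw [Nat.cast_eq_zero] at h; rw [h] at hnd; exact hnd (dvd_zero p)
  have hndB : ¬ p ∣ Bn := by
    have := Fact.mk hp
    rw [← ZMod.natCast_eq_zero_iff, hB1]
    exact one_ne_zero
  have hB0 : (Bn : ℚ) ≠ 0 := by
    intro h; rw [Nat.cast_eq_zero] at h; rw [h] at hndB; exact hndB (dvd_zero p)
  have hu := Subring.mul_mem _ (Subring.pow_mem _ hdm n)
    -- Here p ≡ 1 mod 6 forces p ≥ 7, so 150 = 6 · 5^2 is prime to p.
    (inv_natCast_mem hp (r := 150 * (Bn * C)) (fun h => by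
      rcases hp.dvd_mul.1 h with h | h
      · have h2 : p ∣ 6 * 5 ^ 2 := h
        rcases hp.dvd_mul.1 h2 with h | h
        · exact not_dvd_of_lt (by omega) (by omega) h
        · exact not_dvd_of_lt (by omega) (by omega) (hp.dvd_of_dvd_pow h)
      · rcases hp.dvd_mul.1 h with h | h
        · exact hndB h
        · exact hnd h))
  refine PadicCongr.scale hp 1 hu (hL.trans hp hM) ?_ ?_
  · rw [pow_one, inv_pow]
    push_cast
    field_simp
    rw [hpn]
    linear_combination 150 * (6 * (n : ℚ) + 5) * hX
  · rw [pow_one, div_pow, inv_pow]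
    push_cast
    field_simp
    ring

theorem sum_choose_six_mul_congr_five (hp : p.Prime) (hp3 : 3 < p) (hd : d ≠ 0)
    (hpd : ¬ (p : ℤ) ∣ d.num) (h : p % 6 = 5) (h5 : p ≠ 5) :
    PadicCongr p 2
      (∑ k ∈ Finset.range ((p - 1) / 2 + 1),
        (1 + (108 - d) / 15 * (k : ℚ) ^ 2 + (216 + d) / 30 * (k : ℚ)) *
          (((6 * k).choose (3 * k) : ℚ) * ((3 * k).choose k : ℚ)) /
            (d ^ k * ((2 * k).choose k : ℚ)))
      (-(6 / 5) * (-432 / d) ^ ((p - 1) / 2) * (p : ℚ) *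
        (((4 * p + 1) / 3).choose (p + 1) : ℚ)) := by
  have hdm := inv_mem_of_not_dvd_num hp hd hpd
  obtain ⟨n, hn⟩ := hp.odd_of_ne_two (by omega)
  have hn2 : (p - 1) / 2 = n := by omega
  have hpn : (p : ℚ) = 2 * n + 1 := by rw [hn]; push_cast; ring
  have hmod : (p : ZMod p) = 0 := ZMod.natCast_self p
  have hB := choose_add_half_zmod hp hp3
  have hW := choose_two_mul_sub_one_zmod hp hp3
  have hW2 := choose_three_mul_sub_one_zmod hp hp3
  have h3 := neg_three_pow_half hp hp3
  rw [if_neg (by omega)] at h3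
  have h12 := natCast_pow_sub_one hp (a := 2 * 6) (fun h => by
      rcases hp.dvd_mul.1 h with h | h
      · exact not_dvd_of_lt (by omega) (by omega) h
      · exact not_dvd_of_lt (by omega) (by omega) h)
  obtain ⟨r, hr⟩ : ∃ r, 3 * r = p + 1 := ⟨(p + 1) / 3, by omega⟩
  have hC := choose_prime_add hp (show r < p by omega)
  rw [show (4 * p + 1) / 3 = p + r by omega]
  have hr' := congrArg (fun n : ℕ => (n : ZMod p)) hr
  rw [hn2] at hB h3 ⊢
  rw [sum_choose_six_mul hd]
  -- -432 = -3 · 12^2, so the sign is the quadratic character of -3, which is -1 here.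
  have h432 : (-432 : ZMod p) ^ n = (-3) ^ n * (((2 * 6 : ℕ) : ZMod p) ^ (p - 1)) := by
    rw [show p - 1 = 2 * n by omega, pow_mul, ← mul_pow]
    norm_num
  have hX := six_mul_add_one_mul_choose n
  rw [← hn, show 2 * n = p - 1 by omega] at hX
  rw [show 2 * n = p - 1 by omega]
  generalize (p + n).choose n = Bn at *
  generalize (2 * p - 1).choose (p - 1) = W at *
  generalize (3 * p - 1).choose (p - 1) = W' at *
  generalize ((6 * n).choose (3 * n) : ℚ) * ((3 * n).choose n : ℚ) / ((p - 1).choose n : ℚ) = A at *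
  generalize (p + r).choose (p + 1) = C at *
  have hL : PadicCongr p 1 (((3 * p + 2) * W * W' : ℤ) : ℚ)
      ((-6 * (-432) ^ n * Bn * C : ℤ) : ℚ) := by
    apply PadicCongr.of_zmod_prime hp
    push_cast at hr' ⊢
    rw [h432, h12, h3, hB, hC, hW, hW2, hmod]
    linear_combination -2 * hr' - 2 * hmod
  push_cast at hL
  have hndB : ¬ p ∣ Bn := by
    have := Fact.mk hp
    rw [← ZMod.natCast_eq_zero_iff, hB]
    exact one_ne_zero
  have hB0 : (Bn : ℚ) ≠ 0 := by
    intro h; rw [Nat.cast_eq_zero] at h; rw [h] at hndB; exact hndB (dvd_zero p)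
  have hu := Subring.mul_mem _ (Subring.pow_mem _ hdm n)
    (inv_natCast_mem hp (r := 5 * Bn) (fun h => by
      rcases hp.dvd_mul.1 h with h | h
      · exact not_dvd_of_lt (by omega) (by omega) h
      · exact hndB h))
  refine PadicCongr.scale hp 1 hu hL ?_ ?_
  · rw [pow_one, inv_pow]
    push_cast
    field_simp
    rw [hpn]
    linear_combination (6 * (n : ℚ) + 5) * hX
  · rw [pow_one, div_pow, inv_pow]
    push_cast
    field_simp

end Congruences

theorem corollary1p4 (p : ℕ) (hp : p.Prime) (hp3 : 3 < p) (d : ℚ) (hd : d ≠ 0)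
    (hpd : ¬ (p : ℤ) ∣ d.num) :
    -- the sum with `C(2k, k)`
    PadicCongr p 5
      (∑ k ∈ Finset.range ((p - 1) / 2 + 1),
        (1 + (4 - d) * (k : ℚ) ^ 2 + (8 + d) / 2 * (k : ℚ)) * ((2 * k).choose k : ℚ) / d ^ k)
      ((-1 / d) ^ ((p - 1) / 2) * (p : ℚ) ^ 2 *
        (1 + 2 * (p : ℚ) * fermatQuotient p 2 + (p : ℚ) ^ 2 * fermatQuotient p 2 ^ 2)) ∧
    -- the sum with `C(3k, k)`
    (p % 3 = 1 → PadicCongr p 4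
      (∑ k ∈ Finset.range ((p - 1) / 2 + 1),
        (1 + (27 - 4 * d) / 6 * (k : ℚ) ^ 2 + (27 + 2 * d) / 6 * (k : ℚ)) *
          ((3 * k).choose k : ℚ) / d ^ k)
      ((-1) ^ ((p - 1) / 3) * (27 / d) ^ ((p - 1) / 2) /
          (4 * ((p - 1).choose ((5 * p - 5) / 6) : ℚ)) *
        ((p : ℚ) + 3 * (p : ℚ) ^ 2 -
          (p : ℚ) ^ 3 / 6 * (jacobiSym p 3 : ℚ) *
            (Polynomial.bernoulli (p - 2)).eval (1 / 6 : ℚ)))) ∧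
    (p % 3 = 2 → PadicCongr p 2
      (∑ k ∈ Finset.range ((p - 1) / 2 + 1),
        (1 + (27 - 4 * d) / 6 * (k : ℚ) ^ 2 + (27 + 2 * d) / 6 * (k : ℚ)) *
          ((3 * k).choose k : ℚ) / d ^ k)
      (-(3 / 2) * (-27 / d) ^ ((p - 1) / 2) * (p : ℚ) *
        (((7 * p + 1) / 6).choose (p + 1) : ℚ))) ∧
    -- the sum with `C(4k, 2k)`
    (p % 4 = 1 → PadicCongr p 4
      (∑ k ∈ Finset.range ((p - 1) / 2 + 1),
        (1 + (16 - d) / 3 * (k : ℚ) ^ 2 + (32 + d) / 6 * (k : ℚ)) *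
          ((4 * k).choose (2 * k) : ℚ) / d ^ k)
      ((-1) ^ ((p - 1) / 4) * (64 / d) ^ ((p - 1) / 2) /
          (3 * ((p - 1).choose ((3 * p - 3) / 4) : ℚ)) *
        ((p : ℚ) + 2 * (p : ℚ) ^ 2 -
          (-1) ^ ((p - 1) / 2) * (p : ℚ) ^ 3 * eulerNumber (p - 3)))) ∧
    (p % 4 = 3 → PadicCongr p 2
      (∑ k ∈ Finset.range ((p - 1) / 2 + 1),
        (1 + (16 - d) / 3 * (k : ℚ) ^ 2 + (32 + d) / 6 * (k : ℚ)) *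
          ((4 * k).choose (2 * k) : ℚ) / d ^ k)
      (-(4 / 3) * (-64 / d) ^ ((p - 1) / 2) * (p : ℚ) *
        (((5 * p + 1) / 4).choose (p + 1) : ℚ))) ∧
    -- the sum with `C(6k, 3k) * C(3k, k) / C(2k, k)`
    (p % 6 = 1 → PadicCongr p 4
      (∑ k ∈ Finset.range ((p - 1) / 2 + 1),
        (1 + (108 - d) / 15 * (k : ℚ) ^ 2 + (216 + d) / 30 * (k : ℚ)) *
          (((6 * k).choose (3 * k) : ℚ) * ((3 * k).choose k : ℚ)) /
            (d ^ k * ((2 * k).choose k : ℚ)))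
      ((-1) ^ ((p - 1) / 6) * (432 / d) ^ ((p - 1) / 2) /
          (5 * ((p - 1).choose ((2 * p - 2) / 3) : ℚ)) *
        (2 * (p : ℚ) + 3 * (p : ℚ) ^ 2 -
          (p : ℚ) ^ 3 / 30 * (jacobiSym p 3 : ℚ) *
            (Polynomial.bernoulli (p - 2)).eval (1 / 6 : ℚ)))) ∧
    (p % 6 = 5 → p ≠ 5 → PadicCongr p 2
      (∑ k ∈ Finset.range ((p - 1) / 2 + 1),
        (1 + (108 - d) / 15 * (k : ℚ) ^ 2 + (216 + d) / 30 * (k : ℚ)) *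
          (((6 * k).choose (3 * k) : ℚ) * ((3 * k).choose k : ℚ)) /
            (d ^ k * ((2 * k).choose k : ℚ)))
      (-(6 / 5) * (-432 / d) ^ ((p - 1) / 2) * (p : ℚ) *
        (((4 * p + 1) / 3).choose (p + 1) : ℚ))) := by
  refine ⟨sum_choose_two_mul_congr hp hp3 hd hpd, sum_choose_three_mul_congr_one hp hp3 hd hpd,
    sum_choose_three_mul_congr_two hp hp3 hd hpd,
    sum_choose_four_mul_congr_one hp hp3 hd hpd,
    sum_choose_four_mul_congr_three hp hp3 hd hpd,
    sum_choose_six_mul_congr_one hp hp3 hd hpd,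
    sum_choose_six_mul_congr_five hp hp3 hd hpd⟩
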